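/- **Setting.** Let $n\ge 1$, $k\ge 1$ and $j\in\{0,\dots,k\}$. Let $\mathcal P=\mathcal P^n_{k,j}$ be the set of matrix polynomials $$P(\lambda)=-\lambda^jJ+\sum_{i=0}^k\lambda^iA_i,\qquad J,A_0,\dots,A_k\in\mathbb R^{n,n},\quad J^\top=-J,\quad A_i^\top=A_i\succeq 0\ (i=0,\dots,k),$$ regarded as polynomials of grade $k$, i.e. as tuples of $k+1$ coefficients, with the topology of the space of coefficients and the norm $\big\|\sum_{i=0}^k\lambda^iY_i\big\|_F=\big(\sum_{i=0}^k\|Y_i\|_F^2\big)^{1/2}$. A matrix polynomial $P$ is *singular* if $\det P(\lambda)\equiv 0$ and *regular* otherwise. The *index* of a matrix pencil is the size of the largest block $\lambda\mathcal J_\sigma(0)-I_\sigma$ (the blocks of the eigenvalue $\infty$; $\mathcal J_\sigma(0)$ is the nilpotent Jordan block of size $\sigma$) in its Kronecker canonical form over $\mathbb C$, and $0$ if there is no such block. The *index* of $P(\lambda)=\sum_{i=0}^k\lambda^iY_i$ is the index of its companion pencil $$\lambda\begin{bmatrix}Y_k&&&\\&I&&\\&&\ddots&\\&&&I\end{bmatrix}+\begin{bmatrix}Y_{k-1}&\cdots&Y_1&Y_0\\-I&0&&\\&\ddots&\ddots&\\&&-I&0\end{bmatrix}.$$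 For $P\in\mathcal P$ put (with $\inf\emptyset=\infty$) $$d_{\rm sing}(P)=\inf\{\|\Delta\|_F : P+\Delta\in\mathcal P\text{ is singular}\},\qquad d_{\rm hi}(P)=\inf\{\|\Delta\|_F : P+\Delta\in\mathcal P\text{ has index}\ge 2\}.$$ For $\ell\ge 0$, a skew-symmetric $J\in\mathbb R^{n,n}$ and symmetric $X_0,\dots,X_\ell\succeq 0$ in $\mathbb R^{n,n}$ let $d_{\rm ck}(J,X_0,\dots,X_\ell)$ be the infimum of $$\big\|[\Delta_J,\Delta_{X_0},\dots,\Delta_{X_\ell}]\big\|_F=\Big(\|\Delta_J\|_F^2+\sum_{i=0}^\ell\|\Delta_{X_i}\|_F^2\Big)^{1/2}$$ over all real matrices such that $J+\Delta_J$ is skew-symmetric, every $X_i+\Delta_{X_i}$ is symmetric positive semidefinite, and $\ker(J+\Delta_J)\cap\bigcap_{i=0}^\ell\ker(X_i+\Delta_{X_i})\ne\{0\}$. **Theorem.** (i) For $P(\lambda)=-\lambda^jJ+\sum_{i=0}^k\lambda^iA_i\in\mathcal P$ the following are equivalent: (a) $P$ is singular; (b) the matrix $P(1)$ is singular; (c)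 $\ker J\cap\ker A_0\cap\dots\cap\ker A_k\ne\{0\}$. (ii) For every such $P$, $\;d_{\rm sing}(P)=d_{\rm ck}(J,A_0,\dots,A_k)$. (iii) Let $\mathcal I_{\rm hi}$ be the set of all $P\in\mathcal P$ that are regular and have index greater than one. If $\max\{n,k\}>1$, then the closure of $\mathcal I_{\rm hi}$ in $\mathcal P$ is $$\Big\{-\lambda^jJ+\sum_{i=0}^k\lambda^iA_i\in\mathcal P : \ker A_k\cap\ker A_{k-1}\ne\{0\}\Big\}\quad\text{if } j<k,$$ $$\Big\{-\lambda^kJ+\sum_{i=0}^k\lambda^iA_i\in\mathcal P : \ker J\cap\ker A_k\cap\ker A_{k-1}\ne\{0\}\Big\}\quad\text{if } j=k>1.$$ If $\max\{n,k\}=1$ or $j=k=1$, then $\mathcal I_{\rm hi}=\emptyset$. (iv) Let $P(\lambda)=-\lambda^jJ+\sum_{i=0}^k\lambda^iA_i\in\mathcal P$. If $\max\{n,k\}>1$, then $$d_{\rm hi}(P)=\begin{cases}d_{\rm ck}(0,A_k,A_{k-1})&\text{if } j<k,\\ d_{\rm ck}(J,A_k,A_{k-1})&\text{if } j=k>1.\end{cases}$$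 If $\max\{n,k\}=1$ or $j=k=1$, then $d_{\rm hi}(P)=\infty$. -/

import Mathlib

open scoped ENNReal Polynomial

noncomputable section

namespace DissHam

/-! ### Matrix pencils: Kronecker canonical form and index

A pencil `z E - A` is given by its pair of coefficients `(E, A)`. -/

/-- The four types of blocks of the Kronecker canonical form.  (Blocks of size zero of type
`finite` or `infinite` are `0 × 0` matrices and contribute nothing to a canonical form.) -/
inductive KroneckerBlock : Type
  /-- the `ε × (ε + 1)` block `L_ε` -/
  | right (ε : ℕ) : KroneckerBlock
  /-- the `(η + 1) × η` block `L_ηᵀ` -/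
  | left (η : ℕ) : KroneckerBlock
  /-- the `ρ × ρ` block `z I - J_ρ(μ)` of the finite eigenvalue `μ` -/
  | finite (ρ : ℕ) (μ : ℂ) : KroneckerBlock
  /-- the `σ × σ` block `z J_σ(0) - I` of the eigenvalue infinity -/
  | infinite (σ : ℕ) : KroneckerBlock

/-- The upper triangular Jordan block `J_r(μ)`. -/
def jordanBlock (r : ℕ) (μ : ℂ) : Matrix (Fin r) (Fin r) ℂ :=
  Matrix.of fun p q => if p = q then μ else if (p : ℕ) + 1 = q then 1 else 0

/-- The matrix `[I 0]` with `r` rows and `r + 1` columns. -/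
def idZero (r : ℕ) : Matrix (Fin r) (Fin (r + 1)) ℂ :=
  Matrix.of fun p q => if (p : ℕ) = q then 1 else 0

/-- The matrix `[0 I]` with `r` rows and `r + 1` columns. -/
def zeroId (r : ℕ) : Matrix (Fin r) (Fin (r + 1)) ℂ :=
  Matrix.of fun p q => if (p : ℕ) + 1 = q then 1 else 0

namespace KroneckerBlock

/-- Number of rows of a block. -/
def rows : KroneckerBlock → ℕ
  | right ε => ε
  | left η => η + 1
  | finite ρ _ => ρ
  | infinite σ => σ

/-- Number of columns of a block. -/
def cols : KroneckerBlock → ℕ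
  | right ε => ε + 1
  | left η => η
  | finite ρ _ => ρ
  | infinite σ => σ

/-- The matrix `E` of a block `z E - A`. -/
def matE : (b : KroneckerBlock) → Matrix (Fin b.rows) (Fin b.cols) ℂ
  | right ε => idZero ε
  | left η => (idZero η).transpose
  | finite ρ _ => (1 : Matrix (Fin ρ) (Fin ρ) ℂ)
  | infinite σ => jordanBlock σ 0

/-- The matrix `A` of a block `z E - A`. -/
def matA : (b : KroneckerBlock) → Matrix (Fin b.rows) (Fin b.cols) ℂ
  | right ε => zeroId ε
  | left η => (zeroId η).transpose
  | finite ρ μ => jordanBlock ρ μ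
  | infinite σ => (1 : Matrix (Fin σ) (Fin σ) ℂ)

end KroneckerBlock

/-- `b 0, …, b (r - 1)` are the diagonal blocks of a Kronecker canonical form of the pencil
`z E - A`: there are nonsingular `S`, `T` such that `S (z E - A) T` is the block diagonal pencil
with these blocks (the equivalences `e`, `f` number its rows and columns). -/
def IsKroneckerForm {m n : Type} [Fintype m] [DecidableEq m] [Fintype n] [DecidableEq n]
    (E A : Matrix m n ℂ) {r : ℕ} (b : Fin r → KroneckerBlock) : Prop :=
  ∃ (S : Matrix m m ℂ) (T : Matrix n n ℂ)
    (e : m ≃ (Σ i, Fin (b i).rows)) (f : n ≃ (Σ i, Fin (b i).cols)),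
    IsUnit S ∧ IsUnit T ∧
    S * E * T = (Matrix.blockDiagonal' fun i => (b i).matE).submatrix e f ∧
    S * A * T = (Matrix.blockDiagonal' fun i => (b i).matA).submatrix e f

/-- The index of the pencil `z E - A`: the size of the largest block of the eigenvalue infinity
in its Kronecker canonical form, and `0` if there is no such block. -/
def pencilIndex {m n : Type} [Fintype m] [DecidableEq m] [Fintype n] [DecidableEq n]
    (E A : Matrix m n ℂ) : ℕ∞ :=
  ⨆ (σ : ℕ) (_ : ∃ (r : ℕ) (b : Fin r → KroneckerBlock),
    IsKroneckerForm E A b ∧ ∃ i, b i = KroneckerBlock.infinite σ), (σ : ℕ∞)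

/-! ### Matrix polynomials -/

/-- Real `n × n` matrix polynomials `P(z) = ∑_{i ≤ k} z ^ i P_i` of grade `k` (that is, of degree
at most `k`), given by their coefficients, with the coefficientwise (Euclidean) topology. -/
abbrev MatPoly (n k : ℕ) : Type := Fin (k + 1) → Matrix (Fin n) (Fin n) ℝ

namespace MatPoly

variable {n k : ℕ}

/-- `P(z)` as a matrix with entries in `ℝ[z]`. -/
def toMatrix (P : MatPoly n k) : Matrix (Fin n) (Fin n) ℝ[X] :=
  ∑ i : Fin (k + 1), (Polynomial.X : ℝ[X]) ^ (i : ℕ) • (P i).map Polynomial.C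

/-- The value `P(t)`. -/
def eval (P : MatPoly n k) (t : ℝ) : Matrix (Fin n) (Fin n) ℝ :=
  ∑ i : Fin (k + 1), t ^ (i : ℕ) • P i

/-- `P` is singular: `det P(z)` is the zero polynomial. -/
def IsSingular (P : MatPoly n k) : Prop := P.toMatrix.det = 0

/-- `P` is regular: it is not singular. -/
def IsRegular (P : MatPoly n k) : Prop := ¬ P.IsSingular

/-- The coefficient `diag(P_k, I, …, I)` of `z` in the companion linearization, a `k × k` block
matrix with `n × n` blocks. -/
def companionE (P : MatPoly n k) : Matrix (Fin k × Fin n) (Fin k × Fin n) ℝ :=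
  Matrix.of fun x y =>
    if x.1 = y.1 then
      if (x.1 : ℕ) = 0 then P (Fin.last k) x.2 y.2
      else (1 : Matrix (Fin n) (Fin n) ℝ) x.2 y.2
    else 0

/-- The constant coefficient of the companion linearization: the first block row is
`[P_{k-1}, …, P_1, P_0]`, the blocks just below the diagonal are `-I`, the others vanish. -/
def companionC (P : MatPoly n k) : Matrix (Fin k × Fin n) (Fin k × Fin n) ℝ :=
  Matrix.of fun x y =>
    if (x.1 : ℕ) = 0 then P ⟨k - 1 - (y.1 : ℕ), by omega⟩ x.2 y.2
    else if (x.1 : ℕ) = (y.1 : ℕ) + 1 then -(1 : Matrix (Fin n) (Fin n) ℝ) x.2 y.2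
    else 0

/-- The index of `P`: the index of its companion linearization
`z • companionE P + companionC P = z • companionE P - (-companionC P)`. -/
def index (P : MatPoly n k) : ℕ∞ :=
  pencilIndex (P.companionE.map Complex.ofReal) ((-P.companionC).map Complex.ofReal)

end MatPoly

/-! ### Frobenius norms -/

/-- The square of the Frobenius norm of a real matrix. -/
def frobSq {n : ℕ} (M : Matrix (Fin n) (Fin n) ℝ) : ℝ := ∑ a, ∑ b, M a b ^ 2

/-- The Frobenius norm `‖[P_0, …, P_k]‖_F` of a matrix polynomial. -/
def MatPoly.frob {n k : ℕ} (P : MatPoly n k) : ℝ := Real.sqrt (∑ i, frobSq (P i))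

/-- The Frobenius norm `‖[J, X_0, …, X_l]‖_F`. -/
def tupleFrob {n l : ℕ} (J : Matrix (Fin n) (Fin n) ℝ)
    (X : Fin (l + 1) → Matrix (Fin n) (Fin n) ℝ) : ℝ :=
  Real.sqrt (frobSq J + ∑ i, frobSq (X i))

/-! ### Structured tuples and the distance to a common kernel -/

/-- `(J, X_0, …, X_l)` is structured: `J` is skew-symmetric and all `X_i` are symmetric positive
semidefinite. -/
def IsStructured {n l : ℕ} (J : Matrix (Fin n) (Fin n) ℝ)
    (X : Fin (l + 1) → Matrix (Fin n) (Fin n) ℝ) : Prop :=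
  J.transpose = -J ∧ ∀ i, (X i).PosSemidef

/-- The kernel of a square matrix. -/
def matKer {n : ℕ} (M : Matrix (Fin n) (Fin n) ℝ) : Submodule ℝ (Fin n → ℝ) :=
  LinearMap.ker M.mulVecLin

/-- The common kernel `ker J ∩ ker X_0 ∩ … ∩ ker X_l`. -/
def commonKer {n l : ℕ} (J : Matrix (Fin n) (Fin n) ℝ)
    (X : Fin (l + 1) → Matrix (Fin n) (Fin n) ℝ) : Submodule ℝ (Fin n → ℝ) :=
  matKer J ⊓ ⨅ i, matKer (X i)

/-- The structured distance `d_ck(J, X_0, …, X_l)` to the common kernel. -/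
def distCommonKer {n l : ℕ} (J : Matrix (Fin n) (Fin n) ℝ)
    (X : Fin (l + 1) → Matrix (Fin n) (Fin n) ℝ) : ℝ≥0∞ :=
  ⨅ (ΔJ : Matrix (Fin n) (Fin n) ℝ) (ΔX : Fin (l + 1) → Matrix (Fin n) (Fin n) ℝ)
    (_ : IsStructured (J + ΔJ) (X + ΔX) ∧ commonKer (J + ΔJ) (X + ΔX) ≠ ⊥),
    ENNReal.ofReal (tupleFrob ΔJ ΔX)

/-! ### The class of structured matrix polynomials and the distances in it -/

variable {n k : ℕ}

/-- The matrix polynomial `-z ^ j J + ∑_{i ≤ k} z ^ i A_i`. -/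
def structPoly (j : Fin (k + 1)) (J : Matrix (Fin n) (Fin n) ℝ)
    (A : Fin (k + 1) → Matrix (Fin n) (Fin n) ℝ) : MatPoly n k :=
  fun i => (if i = j then -J else 0) + A i

/-- The class of all `-z ^ j J + ∑_{i ≤ k} z ^ i A_i` with `J` skew-symmetric and all `A_i`
symmetric positive semidefinite. -/
def structClass (n k : ℕ) (j : Fin (k + 1)) : Set (MatPoly n k) :=
  {P | ∃ J A, IsStructured J A ∧ P = structPoly j J A}

/-- The structured distance to singularity. -/
def distSing (j : Fin (k + 1)) (P : MatPoly n k) : ℝ≥0∞ :=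
  ⨅ (Δ : MatPoly n k) (_ : P + Δ ∈ structClass n k j ∧ (P + Δ).IsSingular),
    ENNReal.ofReal Δ.frob

/-- The structured distance to the nearest high index problem. -/
def distHighIndex (j : Fin (k + 1)) (P : MatPoly n k) : ℝ≥0∞ :=
  ⨅ (Δ : MatPoly n k) (_ : P + Δ ∈ structClass n k j ∧ 2 ≤ (P + Δ).index),
    ENNReal.ofReal Δ.frob

/-- The set of all regular polynomials of index greater than one in the class. -/
def highIndexSet (n k : ℕ) (j : Fin (k + 1)) : Set (MatPoly n k) :=
  {P | P ∈ structClass n k j ∧ P.IsRegular ∧ 1 < P.index}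

end DissHam

end

noncomputable section

namespace DissHam

/-! One pairing drives the proof. If a skew-symmetric matrix plus semidefinite matrices annihilates
`u`, pairing with `u` kills the skew term, so every semidefinite form vanishes at `u`; hence every
summand annihilates `u`. Applied to `P(1) = -J + ∑ A_i`, this turns singularity of `P(1)` into a
common kernel (`commonKer_ne_bot_of_det`), and a common kernel vector is a constant null vector of
`P(z)`. Skew and symmetric parts of a coefficient are Frobenius-orthogonal, so polynomial and tuple
perturbations have equal norms, and the two distances in (ii) agree.

High index is expressed by chains at infinity: `u ≠ 0`, `P_k u = 0`, `P_{k-1} u = P_k v`. An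
infinite block of size at least two yields a chain, with or without regularity. Conversely, if
`P(1)` is invertible, a chain produces such a block: the companion pencil `z E - A` has `E - A`
invertible, and the primary decomposition of `(E - A)⁻¹ E` gives a Kronecker form explicitly. As
`pencilIndex` is a supremum over all forms, uniqueness of the form is never needed.

The same pairing puts `u` into the kernels that define `kernelSet`. That set is closed by
compactness of the sphere, and outside the degenerate cases an arbitrarily small structured
perturbation makes its elements regular while keeping a chain. So, within the class, the polynomials
of index at least two lie between `highIndexSet` and its closure `kernelSet`, and `distHighIndex` is
a distance to a kernel condition that involves only `A_k`, `A_{k-1}` and, for `j = k`, `J`. In the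
degenerate cases `k = 1`, a block of size two would need `P_0 u ≠ 0`, which the kernels forbid. -/

lemma pred_lt_add_one (k : ℕ) : k - 1 < k + 1 :=
  Nat.lt_succ_of_le (Nat.sub_le k 1)

/-! ### Cyclic modules and Jordan structure -/

section Cyclic

open Module

variable {B : Type*} [CommRing B] [Algebra ℂ B]

/-- The powers of an element of nilpotency order exactly `e` are linearly independent. -/
lemma linearIndependent_pow_of_nilpotent {e : ℕ} {t : B} (ht : t ^ e = 0)
    (ht' : 0 < e → t ^ (e - 1) ≠ 0) :
    LinearIndependent ℂ fun i : Fin e => t ^ (i : ℕ) := by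
  induction e with
  | zero => exact linearIndependent_empty_type
  | succ e ih =>
    have hte : t ^ e ≠ 0 := by simpa using ht' (Nat.succ_pos e)
    rw [Fintype.linearIndependent_iff]
    intro g hg i
    by_contra hi
    have hex : ∃ m : ℕ, ∃ h : m < e + 1, g ⟨m, h⟩ ≠ 0 := ⟨i, i.2, hi⟩
    classical
    obtain ⟨hm, hgm⟩ := Nat.find_spec hex
    have hmin := fun l => @Nat.find_min _ _ hex l
    set m := Nat.find hex
    -- Multiplying by `t ^ (e - m)`, with `m` the least index of a nonzero coefficient, pushes all
    -- later terms to exponents above `e`; only `g m • t ^ e` survives.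
    have h1 : ∑ i : Fin (e + 1), g i • t ^ ((i : ℕ) + (e - m)) = 0 := by
      have := congrArg (· * t ^ (e - m)) hg
      simpa [Finset.sum_mul, ← pow_add] using this
    rw [Finset.sum_eq_single ⟨m, hm⟩] at h1
    · rw [show m + (e - m) = e by omega] at h1
      exact (smul_ne_zero hgm hte) h1
    · intro b _ hb
      rcases lt_trichotomy (b : ℕ) m with h | h | h
      · have := hmin _ h
        push Not at this
        rw [this b.2, zero_smul]
      · exact absurd (Fin.ext h) hb
      · rw [show (b : ℕ) + (e - m) = (e + 1) + (b - m - 1) by omega, pow_add, ht, zero_mul,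
          smul_zero]
    · simp

/-- Listing the powers of `t` in decreasing order makes multiplication by `ν + t` upper triangular.
The first column has no superdiagonal entry, which is consistent because `t ^ e = 0`. -/
lemma sum_jordanBlock_smul {e : ℕ} {t : B} (ht : t ^ e = 0) (ν : ℂ) (c : B) (q : Fin e) :
    ∑ p : Fin e, jordanBlock e ν p q • (c * t ^ (e - 1 - (p : ℕ))) =
      (algebraMap ℂ B ν + t) * c * t ^ (e - 1 - (q : ℕ)) := by
  have h1 : ∀ p : Fin e, jordanBlock e ν p q • (c * t ^ (e - 1 - (p : ℕ))) =
      (if p = q then ν • (c * t ^ (e - 1 - (p : ℕ))) else 0) +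
        (if (p : ℕ) + 1 = q then c * t ^ (e - 1 - (p : ℕ)) else 0) := by
    intro p
    simp only [jordanBlock, Matrix.of_apply]
    by_cases hp : p = q
    · simp [hp]
    · by_cases hp' : (p : ℕ) + 1 = q <;> simp [hp, hp']
  rw [Finset.sum_congr rfl fun p _ => h1 p, Finset.sum_add_distrib]
  simp only [Finset.sum_ite_eq', Finset.mem_univ, if_true]
  rw [add_mul, add_mul, Algebra.smul_def, mul_assoc]
  congr 1
  by_cases hq : (q : ℕ) = 0
  · rw [Finset.sum_eq_zero]
    · rw [mul_comm t c, mul_assoc, ← pow_succ', hq]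
      rw [show e - 1 - 0 + 1 = e by have := q.2; omega, ht, mul_zero]
    · intro p _
      rw [if_neg (by omega)]
  · rw [Finset.sum_eq_single (⟨q - 1, by omega⟩ : Fin e)]
    · rw [if_pos (by simp; omega), mul_comm t c, mul_assoc, ← pow_succ']
      congr 2
      have := q.2
      simp only
      omega
    · intro p _ hp
      rw [if_neg]
      intro h
      exact hp (Fin.ext (by simp; omega))
    · simp

/-- On a cyclic module `ℂ[x] / (x - μ) ^ e`, the pencil `z x - (x - 1)` consists of a single
Kronecker block. -/
lemma exists_bases_kroneckerBlock {e : ℕ} {μ : ℂ} {x : B} (hfin : finrank ℂ B = e)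
    (hx : (x - algebraMap ℂ B μ) ^ e = 0)
    (hx' : 0 < e → (x - algebraMap ℂ B μ) ^ (e - 1) ≠ 0) :
    ∃ (b : KroneckerBlock) (v : Basis (Fin b.cols) ℂ B) (w : Basis (Fin b.rows) ℂ B),
      (μ = 0 → b = KroneckerBlock.infinite e) ∧
      (∀ q, x * v q = ∑ p, b.matE p q • w p) ∧
      (∀ q, (x - 1) * v q = ∑ p, b.matA p q • w p) := by
  -- A unit multiple `t` of `x - μ` has the same nilpotency order, so its powers form a basis; the
  -- unit `c` leaves room for a different basis on the row side.
  have main : ∀ (t c u : B), IsUnit c → IsUnit u → t = u * (x - algebraMap ℂ B μ) →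
      t ^ e = 0 ∧ ∃ v w : Basis (Fin e) ℂ B,
        (∀ q : Fin e, v q = t ^ (e - 1 - (q : ℕ))) ∧
        (∀ q : Fin e, w q = c * t ^ (e - 1 - (q : ℕ))) := by
    intro t c u hc hu ht
    have ht1 : t ^ e = 0 := by rw [ht, mul_pow, hx, mul_zero]
    have ht2 : 0 < e → t ^ (e - 1) ≠ 0 := by
      intro he h
      rw [ht, mul_pow] at h
      exact hx' he (((hu.pow _).mul_right_eq_zero).1 h)
    have li := linearIndependent_pow_of_nilpotent ht1 ht2
    have li2 : LinearIndependent ℂ fun i : Fin e => t ^ (e - 1 - (i : ℕ)) := by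
      have := li.comp Fin.rev Fin.rev_injective
      convert this using 2 with i
      simp [Function.comp, Fin.val_rev, Nat.sub_sub, add_comm]
    have li3 : LinearIndependent ℂ fun i : Fin e => c * t ^ (e - 1 - (i : ℕ)) := by
      refine li2.map' (LinearMap.mulLeft ℂ c) ?_
      rw [LinearMap.ker_eq_bot]
      exact hc.mul_right_injective
    refine ⟨ht1, ?_⟩
    rcases Nat.eq_zero_or_pos e with he | he
    · subst he
      have : Subsingleton B := by
        have : (1 : B) = 0 := by simpa using hx
        exact subsingleton_of_zero_eq_one this.symm
      exact ⟨Basis.empty _, Basis.empty _, fun q => q.elim0, fun q => q.elim0⟩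
    · have : Nonempty (Fin e) := ⟨⟨0, he⟩⟩
      refine ⟨basisOfLinearIndependentOfCardEqFinrank li2 (by simp [hfin]),
        basisOfLinearIndependentOfCardEqFinrank li3 (by simp [hfin]), ?_, ?_⟩ <;> simp
  have hnil : IsNilpotent (x - algebraMap ℂ B μ) := ⟨e, hx⟩
  by_cases hμ : μ = 0
  · subst hμ
    rw [map_zero, sub_zero] at hnil
    have hu : IsUnit (x - 1) := hnil.isUnit_sub_one
    obtain ⟨u, hu'⟩ := hu.exists_left_inv
    -- Here `x - 1` is invertible. With `w = (x - 1) v` the second matrix is the identity, and `t =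
    -- (x - 1)⁻¹ x` is the nilpotent part.
    obtain ⟨ht, v, w, hv, hw⟩ := main (u * x) (x - 1) u hu (.of_mul_eq_one _ hu') (by simp)
    have hE : ∀ q : Fin e, x * v q = ∑ p : Fin e, jordanBlock e 0 p q • w p := by
      intro q
      simp only [hw, hv]
      rw [sum_jordanBlock_smul ht, map_zero, zero_add]
      linear_combination (-(x * (u * x) ^ (e - 1 - (q : ℕ)))) * hu'
    have hA : ∀ q : Fin e,
        (x - 1) * v q = ∑ p : Fin e, (1 : Matrix (Fin e) (Fin e) ℂ) p q • w p := by
      simp [hw, hv, Matrix.one_apply, ite_smul]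
    exact ⟨.infinite e, v, w, fun _ => rfl, hE, hA⟩
  · have hm : algebraMap ℂ B μ * algebraMap ℂ B μ⁻¹ = 1 := by
      rw [← map_mul, mul_inv_cancel₀ hμ, map_one]
    have hxu : IsUnit x := by
      have := hnil.isUnit_add_left_of_commute (u := algebraMap ℂ B μ)
        (.of_mul_eq_one _ hm) (Commute.all _ _)
      simpa using this
    obtain ⟨y, hy⟩ := hxu.exists_left_inv
    have huu : IsUnit (algebraMap ℂ B μ⁻¹ * y) :=
      IsUnit.mul (.of_mul_eq_one (algebraMap ℂ B μ) (by rw [mul_comm]; exact hm))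
        (.of_mul_eq_one _ hy)
    -- Here `x` is invertible and `w = x v`. The finite eigenvalue is read off from `1 - x⁻¹ = (1 -
    -- μ⁻¹) + μ⁻¹ x⁻¹ (x - μ)`.
    obtain ⟨ht, v, w, hv, hw⟩ := main _ x _ hxu huu rfl
    have hE : ∀ q : Fin e,
        x * v q = ∑ p : Fin e, (1 : Matrix (Fin e) (Fin e) ℂ) p q • w p := by
      simp [hw, hv, Matrix.one_apply, ite_smul]
    have hA : ∀ q : Fin e,
        (x - 1) * v q = ∑ p : Fin e, jordanBlock e (1 - μ⁻¹) p q • w p := by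
      intro q
      simp only [hw, hv]
      rw [sum_jordanBlock_smul ht]
      congr 1
      rw [map_sub, map_one]
      linear_combination (-algebraMap ℂ B μ⁻¹ * (x - algebraMap ℂ B μ)) * hy + hm
    exact ⟨.finite e (1 - μ⁻¹), v, w, fun h => absurd h hμ, hE, hA⟩

end Cyclic

/-- An endomorphism over `ℂ` makes the space a finite product of modules `ℂ[X] / (X - μ) ^ e`. -/
lemma exists_equiv_pi_quotient {V : Type} [AddCommGroup V] [Module ℂ V] [Module.Finite ℂ V]
    (f : Module.End ℂ V) :
    ∃ (r : ℕ) (μ : Fin r → ℂ) (e : Fin r → ℕ)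
      (φ : V ≃ₗ[ℂ] ∀ i, ℂ[X] ⧸ Ideal.span {(Polynomial.X - Polynomial.C (μ i)) ^ e i}),
      ∀ v i, φ (f v) i = Ideal.Quotient.mk _ Polynomial.X * φ v i := by
  classical
  obtain ⟨ι, hι, p, hp, e, ⟨ψ⟩⟩ := Module.equiv_directSum_of_isTorsion
    (Module.AEval.isTorsion_of_finiteDimensional ℂ V f)
  have hroot : ∀ i, ∃ μ : ℂ, Associated (p i) (Polynomial.X - Polynomial.C μ) := by
    intro i
    obtain ⟨μ, hμ⟩ := IsAlgClosed.exists_root (p i)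
      (by rw [IsAlgClosed.degree_eq_one_of_irreducible ℂ (hp i)]; exact one_ne_zero)
    exact ⟨μ, ((Polynomial.irreducible_X_sub_C μ).associated_of_dvd (hp i)
      (Polynomial.dvd_iff_isRoot.2 hμ)).symm⟩
  choose μ hμ using hroot
  have hspan : ∀ i, Submodule.span ℂ[X] {p i ^ e i} =
      Ideal.span {(Polynomial.X - Polynomial.C (μ i)) ^ e i} := fun i =>
    Ideal.span_singleton_eq_span_singleton.2 ((hμ i).pow_pow)
  let σ := (Fintype.equivFin ι).symm
  let χ : Module.AEval' f ≃ₗ[ℂ[X]]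
      ∀ i, ℂ[X] ⧸ Ideal.span {(Polynomial.X - Polynomial.C (μ (σ i))) ^ e (σ i)} :=
    ψ ≪≫ₗ DirectSum.linearEquivFunOnFintype ℂ[X] ι _ ≪≫ₗ
      (LinearEquiv.piCongrLeft' ℂ[X] _ σ.symm) ≪≫ₗ
      LinearEquiv.piCongrRight fun i => Submodule.quotEquivOfEq _ _ (hspan (σ i))
  refine ⟨Fintype.card ι, μ ∘ σ, e ∘ σ,
    (Module.AEval'.of f) ≪≫ₗ χ.restrictScalars ℂ, fun v i => ?_⟩
  have h1 : Module.AEval'.of f (f v) = (Polynomial.X : ℂ[X]) • Module.AEval'.of f v :=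
    (Module.AEval'.X_smul_of f v).symm
  simp only [LinearEquiv.trans_apply, LinearEquiv.restrictScalars_apply, h1, map_smul]
  rfl

/-! ### Building a Kronecker form from a chain at infinity -/

section KroneckerForm

open Module Matrix

lemma isKroneckerForm_of_bases {n : Type} [Fintype n] [DecidableEq n] {E A : Matrix n n ℂ}
    {r : ℕ} {b : Fin r → KroneckerBlock}
    (v : Basis (Σ i, Fin (b i).cols) ℂ (n → ℂ)) (w : Basis (Σ i, Fin (b i).rows) ℂ (n → ℂ))
    (hE : ∀ q, E *ᵥ v q = ∑ p, (blockDiagonal' fun i => (b i).matE) p q • w p)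
    (hA : ∀ q, A *ᵥ v q = ∑ p, (blockDiagonal' fun i => (b i).matA) p q • w p) :
    IsKroneckerForm E A b := by
  let f := (Pi.basisFun ℂ n).indexEquiv v
  let e := (Pi.basisFun ℂ n).indexEquiv w
  let T := (Pi.basisFun ℂ n).toMatrix (v.reindex f.symm)
  let W := (Pi.basisFun ℂ n).toMatrix (w.reindex e.symm)
  have := (Pi.basisFun ℂ n).invertibleToMatrix (v.reindex f.symm)
  have := (Pi.basisFun ℂ n).invertibleToMatrix (w.reindex e.symm)
  have hT : IsUnit T := isUnit_of_invertible _
  have hW : IsUnit W := isUnit_of_invertible _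
  have key : ∀ (X : Matrix n n ℂ) (K : Matrix (Σ i, Fin (b i).rows) (Σ i, Fin (b i).cols) ℂ),
      (∀ q, X *ᵥ v q = ∑ p, K p q • w p) → W⁻¹ * X * T = K.submatrix e f := by
    intro X K hX
    have h1 : X * T = W * K.submatrix e f := by
      ext a c
      have h2 : (X * T) a c = (X *ᵥ v (f c)) a := by
        simp [T, Matrix.mul_apply, Matrix.mulVec, dotProduct, Basis.toMatrix_apply]
      rw [h2, hX, Matrix.mul_apply, ← e.sum_comp]
      simp [W, Basis.toMatrix_apply, mul_comm]
    rw [Matrix.mul_assoc, h1, ← Matrix.mul_assoc,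
      Matrix.nonsing_inv_mul _ ((Matrix.isUnit_iff_isUnit_det _).1 hW), Matrix.one_mul]
  exact ⟨W⁻¹, T, e, f, (Matrix.isUnit_nonsing_inv_iff).2 hW, hT, key E _ hE, key A _ hA⟩

/-- With `M = (E - A)⁻¹ E` one has `E = (E - A) M` and `A = (E - A) (M - 1)`, so a cyclic
decomposition for `M` is a Kronecker form of the pencil. The chain reads `M y = -x`, `M x = 0`. In a
component where `M y` is nonzero, `M` is neither invertible nor zero; the eigenvalue is therefore
`0` and the block has size at least two. -/
lemma two_le_pencilIndex_of_chain {n : Type} [Fintype n] [DecidableEq n] {E A : Matrix n n ℂ}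
    (hreg : IsUnit (E - A)) {x y : n → ℂ} (hx : x ≠ 0) (hEx : E *ᵥ x = 0)
    (hAx : A *ᵥ x = E *ᵥ y) : 2 ≤ pencilIndex E A := by
  classical
  have hdet := (Matrix.isUnit_iff_isUnit_det _).1 hreg
  let M := (E - A)⁻¹ * E
  have hDM : (E - A) * M = E := by
    rw [← Matrix.mul_assoc, Matrix.mul_nonsing_inv _ hdet, Matrix.one_mul]
  obtain ⟨r, μ, e, φ, hφ⟩ := exists_equiv_pi_quotient (Matrix.toLin' M)
  let I : Fin r → Ideal ℂ[X] := fun i =>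
    Ideal.span {(Polynomial.X - Polynomial.C (μ i)) ^ e i}
  let ξ : ∀ i, ℂ[X] ⧸ I i := fun i => Ideal.Quotient.mk _ Polynomial.X
  have hpow : ∀ i m, (ξ i - algebraMap ℂ _ (μ i)) ^ m = 0 ↔ e i ≤ m := by
    intro i m
    have : (ξ i - algebraMap ℂ _ (μ i)) ^ m =
        Ideal.Quotient.mk (I i) ((Polynomial.X - Polynomial.C (μ i)) ^ m) := by
      simp [ξ]; rfl
    rw [this, Ideal.Quotient.eq_zero_iff_mem, Ideal.mem_span_singleton,
      pow_dvd_pow_iff (Polynomial.X_sub_C_ne_zero _) (Polynomial.not_isUnit_X_sub_C _)]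
  have hblocks := fun i => exists_bases_kroneckerBlock (B := ℂ[X] ⧸ I i) (e := e i) (μ := μ i)
    (x := ξ i) (by rw [finrank_quotient_span_eq_natDegree]; simp) ((hpow i _).2 le_rfl)
    (fun h h' => by have := (hpow i _).1 h'; omega)
  choose b v w hb hvE hvA using hblocks
  let D : (n → ℂ) ≃ₗ[ℂ] (n → ℂ) := Matrix.toLinearEquiv' (E - A) hreg.invertible
  have hD : ∀ u, D u = (E - A) *ᵥ u := fun u => rfl
  let vB := (Pi.basis v).map φ.symm
  let wB := ((Pi.basis w).map φ.symm).map D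
  have single : ∀ (K : ∀ i, Matrix (Fin (b i).rows) (Fin (b i).cols) ℂ) (i) (q),
      D (φ.symm (Pi.single i (∑ p, K i p q • w i p))) =
        ∑ p, blockDiagonal' K p ⟨i, q⟩ • wB p := by
    intro K i q
    rw [Fintype.sum_sigma, Finset.sum_eq_single i]
    · simp only [blockDiagonal'_apply_eq, wB, Basis.map_apply, ← map_smul, ← map_sum,
        Pi.basis_apply]
      congr 2
      ext j
      by_cases hj : j = i
      · subst hj; simp
      · simp [hj]
    · intro j _ hj
      refine Finset.sum_eq_zero fun p _ => ?_
      rw [blockDiagonal'_apply_ne _ _ _ hj, zero_smul]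
    · simp
  have hM : ∀ u : ∀ i, ℂ[X] ⧸ I i, M *ᵥ φ.symm u = φ.symm (fun i => ξ i * u i) := by
    intro u
    apply φ.injective
    ext i
    rw [φ.apply_symm_apply]
    have := hφ (φ.symm u) i
    rw [φ.apply_symm_apply] at this
    exact this
  have hform : IsKroneckerForm E A b := by
    refine isKroneckerForm_of_bases vB wB ?_ ?_
    · rintro ⟨i, q⟩
      rw [← single, ← hvE, hD]
      conv_lhs => rw [← hDM, ← Matrix.mulVec_mulVec]
      simp only [vB, Basis.map_apply, hM, Pi.basis_apply]
      congr 2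
      ext j
      by_cases hj : j = i
      · subst hj; simp
      · simp [hj]
    · rintro ⟨i, q⟩
      rw [← single, ← hvA, hD]
      have : A = (E - A) * (M - 1) := by rw [mul_sub, hDM]; simp
      conv_lhs => rw [this, ← Matrix.mulVec_mulVec]
      simp only [vB, Basis.map_apply, Matrix.sub_mulVec M 1, Matrix.one_mulVec, hM,
        Pi.basis_apply]
      rw [← map_sub]
      refine congrArg _ (congrArg _ ?_)
      ext j
      by_cases hj : j = i
      · subst hj; simp [sub_mul]
      · simp [hj]
  have hMx : M *ᵥ x = 0 := by rw [← Matrix.mulVec_mulVec, hEx, Matrix.mulVec_zero]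
  have hMy : M *ᵥ y = -x := by
    have : (E - A) *ᵥ x = -(E *ᵥ y) := by rw [Matrix.sub_mulVec, hEx, hAx, zero_sub]
    have h2 : (E - A)⁻¹ *ᵥ ((E - A) *ᵥ x) = x := by
      rw [Matrix.mulVec_mulVec, Matrix.nonsing_inv_mul _ hdet, Matrix.one_mulVec]
    rw [← Matrix.mulVec_mulVec, ← h2, this, Matrix.mulVec_neg, neg_neg]
  have hne : φ (M *ᵥ y) ≠ 0 := by
    rw [hMy]; simpa using hx
  obtain ⟨i, hi⟩ := Function.ne_iff.1 hne
  have h1 : φ (M *ᵥ y) i = ξ i * φ y i := hφ y i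
  have h2 : ξ i * (ξ i * φ y i) = 0 := by
    rw [← h1]
    have := hφ (M *ᵥ y) i
    rw [Matrix.toLin'_apply, hMy, Matrix.mulVec_neg, hMx, neg_zero, map_zero, ← hMy] at this
    exact this.symm
  have hμ : μ i = 0 := by
    by_contra hμ
    have hnil : IsNilpotent (ξ i - algebraMap ℂ _ (μ i)) := ⟨e i, (hpow i _).2 le_rfl⟩
    have hunit : IsUnit (ξ i) := by
      have := hnil.isUnit_add_left_of_commute (u := algebraMap ℂ (ℂ[X] ⧸ I i) (μ i))
        ((IsUnit.mk0 _ hμ).map _) (Commute.all _ _)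
      simpa using this
    exact hi (h1.trans (hunit.mul_right_eq_zero.1 h2))
  have he : 2 ≤ e i := by
    by_contra he
    have : (ξ i - algebraMap ℂ _ (μ i)) ^ 1 = 0 := (hpow i 1).2 (by omega)
    rw [hμ, map_zero, sub_zero, pow_one] at this
    exact hi (by rw [h1, this, zero_mul]; rfl)
  refine le_trans (b := (e i : ℕ∞)) (by exact_mod_cast he) ?_
  exact le_iSup₂ (f := fun (σ : ℕ) (_ : ∃ (r : ℕ) (b : Fin r → KroneckerBlock),
    IsKroneckerForm E A b ∧ ∃ i, b i = KroneckerBlock.infinite σ) => (σ : ℕ∞))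
    (e i) ⟨r, b, hform, i, hb i hμ⟩

end KroneckerForm

/-! ### Chains at infinity for pencils and companion linearizations -/

section Companion

open Matrix

lemma KroneckerBlock.exists_chain_of_infinite {b : KroneckerBlock} {σ : ℕ}
    (hb : b = .infinite σ) (hσ : 2 ≤ σ) :
    ∃ c d : Fin b.cols, (∀ p, b.matE p c = 0) ∧ (∀ p, b.matE p d = b.matA p c) ∧
      ∃ p, b.matA p c ≠ 0 := by
  subst hb
  have hE : ∃ c d : Fin σ, (∀ p : Fin σ, jordanBlock σ 0 p c = 0) ∧
      (∀ p : Fin σ, jordanBlock σ 0 p d = (1 : Matrix (Fin σ) (Fin σ) ℂ) p c) ∧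
      ∃ p : Fin σ, (1 : Matrix (Fin σ) (Fin σ) ℂ) p c ≠ 0 := by
    refine ⟨⟨0, by omega⟩, ⟨1, by omega⟩, fun p => ?_, fun p => ?_, ⟨0, by omega⟩, by simp⟩
    · simp [jordanBlock]
    · simp only [jordanBlock, Matrix.of_apply, Matrix.one_apply, Fin.ext_iff]
      split_ifs <;> first | rfl | omega
  exact hE

/-- The chain consists of the two columns of `T` that meet the first two columns of the infinite
block. Recording `A x ≠ 0`, not merely `x ≠ 0`, is what later settles the degenerate cases. -/
lemma exists_complex_chain_of_two_le_pencilIndex {m n : Type} [Fintype m] [DecidableEq m]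
    [Fintype n] [DecidableEq n] {E A : Matrix m n ℂ} (h : 2 ≤ pencilIndex E A) :
    ∃ x y : n → ℂ, E *ᵥ x = 0 ∧ A *ᵥ x = E *ᵥ y ∧ A *ᵥ x ≠ 0 := by
  have h1 : 1 < pencilIndex E A := lt_of_lt_of_le (by norm_num) h
  obtain ⟨σ, h2⟩ := lt_iSup_iff.1 h1
  obtain ⟨⟨r, b, ⟨S, T, e, f, hS, hT, hE, hA⟩, i, hi⟩, hσ⟩ := lt_iSup_iff.1 h2
  have hσ' : 2 ≤ σ := by
    have : 1 < σ := by exact_mod_cast hσ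
    omega
  obtain ⟨c, d, hc, hd, p, hp⟩ := KroneckerBlock.exists_chain_of_infinite hi hσ'
  let x : n → ℂ := fun a => T a (f.symm ⟨i, c⟩)
  let y : n → ℂ := fun a => T a (f.symm ⟨i, d⟩)
  have hcol : ∀ (X : Matrix m n ℂ) (K : Matrix (Σ i, Fin (b i).rows) (Σ i, Fin (b i).cols) ℂ),
      S * X * T = K.submatrix e f → ∀ (q) (a), (S *ᵥ (X *ᵥ fun a => T a (f.symm q))) a =
        K (e a) q := by
    intro X K hX q a
    have := congrFun (congrFun hX a) (f.symm q)
    rw [Matrix.mulVec_mulVec]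
    simpa [Matrix.mul_apply, Matrix.mulVec, dotProduct] using this
  have hinj := Matrix.mulVec_injective_of_isUnit hS
  refine ⟨x, y, hinj ?_, hinj ?_, fun h0 => ?_⟩
  · rw [Matrix.mulVec_zero]
    ext a
    rw [hcol E _ hE]
    obtain ⟨l, p'⟩ := e a
    by_cases hl : l = i
    · subst hl; simp [blockDiagonal'_apply_eq, hc]
    · rw [blockDiagonal'_apply_ne _ _ _ hl]; rfl
  · ext a
    rw [hcol E _ hE, hcol A _ hA]
    obtain ⟨l, p'⟩ := e a
    by_cases hl : l = i
    · subst hl; simp [blockDiagonal'_apply_eq, hd]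
    · rw [blockDiagonal'_apply_ne _ _ _ hl, blockDiagonal'_apply_ne _ _ _ hl]
  · have := hcol A _ hA ⟨i, c⟩ (e.symm ⟨i, p⟩)
    rw [Equiv.apply_symm_apply, blockDiagonal'_apply_eq] at this
    apply hp
    rw [← this]
    change (S *ᵥ (A *ᵥ x)) _ = 0
    rw [h0, Matrix.mulVec_zero]
    rfl

lemma re_map_ofReal_mulVec {m n : Type} [Fintype n] (M : Matrix m n ℝ) (x : n → ℂ) (a : m) :
    (((M.map Complex.ofReal) *ᵥ x) a).re = (M *ᵥ fun b => (x b).re) a := by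
  simp [Matrix.mulVec, dotProduct]

lemma im_map_ofReal_mulVec {m n : Type} [Fintype n] (M : Matrix m n ℝ) (x : n → ℂ) (a : m) :
    (((M.map Complex.ofReal) *ᵥ x) a).im = (M *ᵥ fun b => (x b).im) a := by
  simp [Matrix.mulVec, dotProduct]

lemma exists_chain_of_two_le_pencilIndex {m n : Type} [Fintype m] [DecidableEq m]
    [Fintype n] [DecidableEq n] {E A : Matrix m n ℝ}
    (h : 2 ≤ pencilIndex (E.map Complex.ofReal) (A.map Complex.ofReal)) :
    ∃ x y : n → ℝ, E *ᵥ x = 0 ∧ A *ᵥ x = E *ᵥ y ∧ A *ᵥ x ≠ 0 := by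
  obtain ⟨x, y, hx, hy, hne⟩ := exists_complex_chain_of_two_le_pencilIndex h
  -- The matrices are real, so real and imaginary parts are both chains; one of them keeps `A x ≠
  -- 0`.
  by_cases h0 : A *ᵥ (fun b => (x b).re) = 0
  · refine ⟨fun b => (x b).im, fun b => (y b).im, ?_, ?_, fun h1 => hne ?_⟩
    · ext a; rw [← im_map_ofReal_mulVec, hx]; rfl
    · ext a; rw [← im_map_ofReal_mulVec, ← im_map_ofReal_mulVec, hy]
    · ext a
      apply Complex.ext
      · rw [re_map_ofReal_mulVec, h0]; rfl
      · rw [im_map_ofReal_mulVec, h1]; rfl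
  · refine ⟨fun b => (x b).re, fun b => (y b).re, ?_, ?_, h0⟩
    · ext a; rw [← re_map_ofReal_mulVec, hx]; rfl
    · ext a; rw [← re_map_ofReal_mulVec, ← re_map_ofReal_mulVec, hy]

lemma two_le_pencilIndex_of_real_chain {n : Type} [Fintype n] [DecidableEq n] {E A : Matrix n n ℝ}
    (hreg : IsUnit (E - A)) {x y : n → ℝ} (hx : x ≠ 0) (hEx : E *ᵥ x = 0)
    (hAx : A *ᵥ x = E *ᵥ y) :
    2 ≤ pencilIndex (E.map Complex.ofReal) (A.map Complex.ofReal) := by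
  have hmap : ∀ (M : Matrix n n ℝ) (v : n → ℝ),
      M.map Complex.ofReal *ᵥ (fun a => (v a : ℂ)) = fun a => ((M *ᵥ v) a : ℂ) := by
    intro M v
    ext a
    simp [Matrix.mulVec, dotProduct]
  refine two_le_pencilIndex_of_chain (x := fun a => (x a : ℂ)) (y := fun a => (y a : ℂ))
    ?_ ?_ ?_ ?_
  · have := hreg.map (Complex.ofRealHom.mapMatrix (m := n))
    rw [map_sub] at this
    exact this
  · intro h
    apply hx
    ext a
    simpa using congrFun h a
  · rw [hmap, hEx]; ext; simp
  · rw [hmap, hmap, hAx]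

namespace MatPoly

variable {n k : ℕ} (P : MatPoly n k)

lemma companionE_mulVec (hk : 0 < k) (x : Fin k × Fin n → ℝ) (i : Fin k) (a : Fin n) :
    (P.companionE *ᵥ x) (i, a) =
      if (i : ℕ) = 0 then (P (Fin.last k) *ᵥ fun c => x (⟨0, hk⟩, c)) a else x (i, a) := by
  have h0 : (P.companionE *ᵥ x) (i, a) = ∑ c, (if (i : ℕ) = 0 then P (Fin.last k) a c
      else (1 : Matrix (Fin n) (Fin n) ℝ) a c) * x (i, c) := by
    rw [Matrix.mulVec, dotProduct, Fintype.sum_prod_type, Finset.sum_eq_single i]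
    · simp [companionE]
    · intro j _ hj
      simp [companionE, hj.symm]
    · simp
  rw [h0]
  by_cases hi : (i : ℕ) = 0
  · have : i = ⟨0, hk⟩ := Fin.ext hi
    subst this
    simp [Matrix.mulVec, dotProduct]
  · simp [hi, Matrix.one_apply]

lemma companionC_mulVec (x : Fin k × Fin n → ℝ) (i : Fin k) (a : Fin n) :
    (P.companionC *ᵥ x) (i, a) =
      if (i : ℕ) = 0 then
        ∑ l : Fin k, (P ⟨k - 1 - (l : ℕ), by omega⟩ *ᵥ fun c => x (l, c)) a
      else -x (⟨i - 1, by omega⟩, a) := by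
  rw [Matrix.mulVec, dotProduct, Fintype.sum_prod_type]
  by_cases hi : (i : ℕ) = 0
  · simp [companionC, hi, Matrix.mulVec, dotProduct]
  · rw [if_neg hi, Finset.sum_eq_single (⟨i - 1, by omega⟩ : Fin k)]
    · have : (i : ℕ) = i - 1 + 1 := by omega
      simp [companionC, hi, ← this, Matrix.one_apply]
    · intro l _ hl
      have : (i : ℕ) ≠ l + 1 := fun h => hl (Fin.ext (by simp; omega))
      simp [companionC, hi, this]
    · simp

/-- The identity blocks of `companionE` force all blocks of `x` but the first to vanish, so the
first block row carries the whole chain. For `k = 1` it is the only row, hence the extra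
nonvanishing. -/
lemma exists_chain_of_two_le_index (hk : 1 ≤ k) (h : 2 ≤ P.index) :
    ∃ u v : Fin n → ℝ, u ≠ 0 ∧ P (Fin.last k) *ᵥ u = 0 ∧
      P ⟨k - 1, pred_lt_add_one k⟩ *ᵥ u = P (Fin.last k) *ᵥ v ∧
      (k = 1 → P ⟨k - 1, pred_lt_add_one k⟩ *ᵥ u ≠ 0) := by
  obtain ⟨x, y, hx, hy, hne⟩ := exists_chain_of_two_le_pencilIndex h
  have hx0 : ∀ (i : Fin k) (a : Fin n), (i : ℕ) ≠ 0 → x (i, a) = 0 := by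
    intro i a hi
    have := congrFun hx (i, a)
    rwa [companionE_mulVec P hk, if_neg hi] at this
  have hrow : ∀ a, (P.companionC *ᵥ x) (⟨0, hk⟩, a) =
      (P ⟨k - 1, pred_lt_add_one k⟩ *ᵥ fun c => x (⟨0, hk⟩, c)) a := by
    intro a
    rw [companionC_mulVec, if_pos rfl, Finset.sum_eq_single ⟨0, hk⟩]
    · rfl
    · intro l _ hl
      have : (fun c => x (l, c)) = 0 := by
        ext c
        exact hx0 l c fun h => hl (Fin.ext h)
      rw [this, Matrix.mulVec_zero]; rfl
    · simp
  refine ⟨fun a => x (⟨0, hk⟩, a), -fun a => y (⟨0, hk⟩, a), fun h0 => hne ?_, ?_, ?_,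
    fun hk1 h0 => hne ?_⟩
  · have : x = 0 := by
      ext ⟨i, a⟩
      by_cases hi : (i : ℕ) = 0
      · have : i = ⟨0, hk⟩ := Fin.ext hi
        subst this
        exact congrFun h0 a
      · exact hx0 i a hi
    rw [this, Matrix.mulVec_zero]
  · ext a
    have := congrFun hx (⟨0, hk⟩, a)
    rwa [companionE_mulVec P hk, if_pos rfl] at this
  · ext a
    have := congrFun hy (⟨0, hk⟩, a)
    rw [companionE_mulVec P hk, if_pos rfl, Matrix.neg_mulVec, Pi.neg_apply, hrow] at this
    rw [Matrix.mulVec_neg, Pi.neg_apply, ← this, neg_neg]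
  · ext ⟨i, a⟩
    have : i = ⟨0, hk⟩ := Fin.ext (by simp; omega)
    subst this
    rw [Matrix.neg_mulVec, Pi.neg_apply, hrow, h0]
    simp

/-- This matrix is the companion pencil at `z = 1`. Its lower rows make all blocks of a null vector
equal, and its first row then applies `P(1)` to the common block. -/
lemma isUnit_companion (hk : 1 ≤ k) (h : (P.eval 1).det ≠ 0) :
    IsUnit (P.companionE - -P.companionC) := by
  rw [sub_neg_eq_add, Matrix.isUnit_iff_isUnit_det, isUnit_iff_ne_zero]
  intro hdet
  obtain ⟨x, hx, hx0⟩ := Matrix.exists_mulVec_eq_zero_iff.2 hdet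
  rw [Matrix.add_mulVec] at hx0
  have hconst : ∀ (m : ℕ) (hm : m < k) (a : Fin n), x (⟨m, hm⟩, a) = x (⟨0, hk⟩, a) := by
    intro m
    induction m with
    | zero => intro _ _; rfl
    | succ m ih =>
      intro hm a
      have := congrFun hx0 (⟨m + 1, hm⟩, a)
      rw [Pi.add_apply, companionE_mulVec P hk, companionC_mulVec, if_neg (by simp),
        if_neg (by simp)] at this
      rw [← ih (by omega)]
      simp only [Nat.add_sub_cancel, Pi.zero_apply] at this
      linarith
  apply h
  rw [← Matrix.exists_mulVec_eq_zero_iff]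
  refine ⟨fun a => x (⟨0, hk⟩, a), fun h0 => hx ?_, ?_⟩
  · ext ⟨i, a⟩
    rw [show i = ⟨i, i.2⟩ from rfl, hconst]
    exact congrFun h0 a
  · ext a
    have := congrFun hx0 (⟨0, hk⟩, a)
    rw [Pi.add_apply, companionE_mulVec P hk, companionC_mulVec, if_pos rfl, if_pos rfl] at this
    rw [MatPoly.eval, Fin.sum_univ_castSucc, ← Equiv.sum_comp Fin.revPerm]
    simp only [one_pow, one_smul, Matrix.add_mulVec, Matrix.sum_mulVec, Pi.add_apply,
      Finset.sum_apply]
    rw [add_comm]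
    refine Eq.trans (Eq.symm ?_) this
    refine congrArg _ (Finset.sum_congr rfl fun l _ => ?_)
    have h1 : (fun c => x (l, c)) = fun c => x (⟨0, hk⟩, c) := by
      ext c
      rw [show l = ⟨l, l.2⟩ from rfl, hconst]
    rw [h1]
    congr 3
    simp
    omega

lemma two_le_index_of_chain (hk : 1 ≤ k) (h : (P.eval 1).det ≠ 0) {u v : Fin n → ℝ}
    (hu : u ≠ 0) (hPu : P (Fin.last k) *ᵥ u = 0)
    (hPv : P ⟨k - 1, pred_lt_add_one k⟩ *ᵥ u = P (Fin.last k) *ᵥ v) : 2 ≤ P.index := by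
  let x : Fin k × Fin n → ℝ := fun p => if (p.1 : ℕ) = 0 then u p.2 else 0
  -- The lower rows of the companion pencil demand that `y` be `x` shifted down by one block; the
  -- sign of `v` comes from `A = -companionC`.
  let y : Fin k × Fin n → ℝ := fun p =>
    if (p.1 : ℕ) = 0 then -v p.2 else x (⟨p.1 - 1, by omega⟩, p.2)
  refine two_le_pencilIndex_of_real_chain (P.isUnit_companion hk h) (x := x) (y := y) ?_ ?_ ?_
  · intro h0
    apply hu
    ext a
    simpa [x] using congrFun h0 (⟨0, hk⟩, a)
  · ext ⟨i, a⟩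
    rw [companionE_mulVec P hk]
    by_cases hi : (i : ℕ) = 0
    · simpa [hi, x] using congrFun hPu a
    · simp [hi, x]
  · ext ⟨i, a⟩
    rw [companionE_mulVec P hk, Matrix.neg_mulVec, Pi.neg_apply, companionC_mulVec]
    by_cases hi : (i : ℕ) = 0
    · rw [if_pos hi, if_pos hi, Finset.sum_eq_single ⟨0, hk⟩]
      · have h1 : (fun c => x (⟨0, hk⟩, c)) = u := by ext; simp [x]
        have h2 : (fun c => y (⟨0, hk⟩, c)) = -v := by ext; simp [y]
        rw [h1, h2, Matrix.mulVec_neg, ← hPv]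
        rfl
      · intro l _ hl
        have : (fun c => x (l, c)) = 0 := by
          ext c
          have : (l : ℕ) ≠ 0 := fun h => hl (Fin.ext h)
          simp [x, this]
        rw [this, Matrix.mulVec_zero]; rfl
      · simp
    · simp [hi, y]

end MatPoly

end Companion

section StructuredClass

open Matrix

/-! ### Skew-symmetric and positive semidefinite matrices -/

section Structured

variable {n k : ℕ} {j : Fin (k + 1)}

lemma dotProduct_mulVec_self_of_skew {J : Matrix (Fin n) (Fin n) ℝ} (hJ : Jᵀ = -J)
    (u : Fin n → ℝ) : u ⬝ᵥ J *ᵥ u = 0 := by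
  have h : u ⬝ᵥ J *ᵥ u = -(u ⬝ᵥ J *ᵥ u) := by
    conv_lhs => rw [dotProduct_mulVec, ← mulVec_transpose, hJ, dotProduct_comm]
    rw [neg_mulVec, dotProduct_neg]
  linarith

lemma mulVec_eq_zero_of_dotProduct {X : Matrix (Fin n) (Fin n) ℝ} (hX : X.PosSemidef)
    {u : Fin n → ℝ} (h : u ⬝ᵥ X *ᵥ u = 0) : X *ᵥ u = 0 :=
  (hX.dotProduct_mulVec_zero_iff u).1 (by simpa using h)

lemma dotProduct_mulVec_nonneg {X : Matrix (Fin n) (Fin n) ℝ} (hX : X.PosSemidef)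
    (u : Fin n → ℝ) : 0 ≤ u ⬝ᵥ X *ᵥ u := by
  simpa using hX.dotProduct_mulVec_nonneg u

lemma transpose_of_posSemidef {X : Matrix (Fin n) (Fin n) ℝ} (hX : X.PosSemidef) : Xᵀ = X := by
  simpa [Matrix.IsHermitian, Matrix.conjTranspose_eq_transpose_of_trivial] using hX.isHermitian

/-- A chain of length two at infinity for `z (K + X) + (L + Z)` lies in the kernels of the
skew-symmetric and of the semidefinite parts. -/
lemma mulVec_eq_zero_of_chain {K L X Z : Matrix (Fin n) (Fin n) ℝ} (hK : Kᵀ = -K)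
    (hL : Lᵀ = -L) (hX : X.PosSemidef) (hZ : Z.PosSemidef) {u v : Fin n → ℝ}
    (hu : (K + X) *ᵥ u = 0) (hv : (L + Z) *ᵥ u = (K + X) *ᵥ v) :
    K *ᵥ u = 0 ∧ X *ᵥ u = 0 ∧ Z *ᵥ u = 0 := by
  have hXu : X *ᵥ u = 0 := by
    apply mulVec_eq_zero_of_dotProduct hX
    have := congrArg (u ⬝ᵥ ·) hu
    simpa [add_mulVec, dotProduct_add, dotProduct_mulVec_self_of_skew hK] using this
  have hKu : K *ᵥ u = 0 := by simpa [add_mulVec, hXu] using hu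
  refine ⟨hKu, hXu, mulVec_eq_zero_of_dotProduct hZ ?_⟩
  -- The right side becomes `((-K + X) u) ⬝ v = 0`, the left side the quadratic form of `Z` at `u`.
  have := congrArg (u ⬝ᵥ ·) hv
  simp only [add_mulVec L Z, dotProduct_add, dotProduct_mulVec_self_of_skew hL, zero_add] at this
  rw [this, dotProduct_mulVec, ← mulVec_transpose, transpose_add, hK, transpose_of_posSemidef hX,
    add_mulVec, neg_mulVec, hKu, hXu]
  simp

lemma mem_commonKer {l : ℕ} {J : Matrix (Fin n) (Fin n) ℝ}
    {X : Fin (l + 1) → Matrix (Fin n) (Fin n) ℝ} {u : Fin n → ℝ} :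
    u ∈ commonKer J X ↔ J *ᵥ u = 0 ∧ ∀ i, X i *ᵥ u = 0 := by
  simp [commonKer, matKer]

lemma structPoly_of_ne {J : Matrix (Fin n) (Fin n) ℝ}
    {A : Fin (k + 1) → Matrix (Fin n) (Fin n) ℝ} {i : Fin (k + 1)} (h : i ≠ j) :
    structPoly j J A i = A i := by
  simp [structPoly, h]

lemma skew_ite {J : Matrix (Fin n) (Fin n) ℝ} (hJ : Jᵀ = -J) (p : Prop) [Decidable p] :
    (if p then -J else 0)ᵀ = -(if p then -J else 0) := by
  split_ifs <;> simp [hJ]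

/-! ### Singular polynomials -/

lemma eval_one_structPoly (J : Matrix (Fin n) (Fin n) ℝ)
    (A : Fin (k + 1) → Matrix (Fin n) (Fin n) ℝ) :
    (structPoly j J A).eval 1 = -J + ∑ i, A i := by
  simp [MatPoly.eval, structPoly, Finset.sum_add_distrib]

lemma det_eval_one_eq_zero {P : MatPoly n k} (h : P.IsSingular) : (P.eval 1).det = 0 := by
  have h1 : P.eval 1 = (Polynomial.evalRingHom (1 : ℝ)).mapMatrix P.toMatrix := by
    ext a b
    simp [MatPoly.eval, MatPoly.toMatrix, Matrix.sum_apply]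
  rw [h1, ← RingHom.map_det, show P.toMatrix.det = 0 from h, map_zero]

lemma commonKer_ne_bot_of_det {J : Matrix (Fin n) (Fin n) ℝ}
    {A : Fin (k + 1) → Matrix (Fin n) (Fin n) ℝ} (hs : IsStructured J A)
    (h : ((structPoly j J A).eval 1).det = 0) : commonKer J A ≠ ⊥ := by
  obtain ⟨u, hu, hu0⟩ := Matrix.exists_mulVec_eq_zero_iff.2 h
  rw [eval_one_structPoly, add_mulVec] at hu0
  have hA : ∀ i, A i *ᵥ u = 0 := by
    have h1 := congrArg (u ⬝ᵥ ·) hu0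
    simp only [dotProduct_add, neg_mulVec, dotProduct_neg, dotProduct_mulVec_self_of_skew hs.1,
      sum_mulVec, dotProduct_sum, dotProduct_zero, neg_zero, zero_add] at h1
    rw [Finset.sum_eq_zero_iff_of_nonneg fun i _ => dotProduct_mulVec_nonneg (hs.2 i) u] at h1
    exact fun i => mulVec_eq_zero_of_dotProduct (hs.2 i) (h1 i (Finset.mem_univ i))
  rw [Submodule.ne_bot_iff]
  refine ⟨u, mem_commonKer.2 ⟨?_, hA⟩, hu⟩
  simpa [sum_mulVec, hA, neg_mulVec] using hu0

lemma isSingular_of_commonKer_ne_bot {J : Matrix (Fin n) (Fin n) ℝ}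
    {A : Fin (k + 1) → Matrix (Fin n) (Fin n) ℝ} (h : commonKer J A ≠ ⊥) :
    (structPoly j J A).IsSingular := by
  obtain ⟨u, hu, hu0⟩ := (Submodule.ne_bot_iff _).1 h
  obtain ⟨hJ, hA⟩ := mem_commonKer.1 hu
  refine Matrix.exists_mulVec_eq_zero_iff.1 ⟨fun a => Polynomial.C (u a), fun h0 => hu0 ?_, ?_⟩
  · ext a
    simpa using congrFun h0 a
  · rw [MatPoly.toMatrix, sum_mulVec]
    refine Finset.sum_eq_zero fun i _ => ?_
    have h1 : structPoly j J A i *ᵥ u = 0 := by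
      by_cases hi : i = j <;> simp [structPoly, hi, add_mulVec, neg_mulVec, hJ, hA]
    have h2 : (structPoly j J A i).map Polynomial.C *ᵥ (fun a => Polynomial.C (u a)) = 0 := by
      ext1 a
      have := RingHom.map_mulVec Polynomial.C (structPoly j J A i) u a
      rw [h1] at this
      simpa [Function.comp_def] using this.symm
    rw [smul_mulVec, h2, smul_zero]

/-! ### High index polynomials and common kernels -/

lemma exists_chain_ker_of_two_le_index (hk : 1 ≤ k) {J : Matrix (Fin n) (Fin n) ℝ}
    {A : Fin (k + 1) → Matrix (Fin n) (Fin n) ℝ} (hs : IsStructured J A)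
    (h : 2 ≤ (structPoly j J A).index) :
    ∃ u : Fin n → ℝ, u ≠ 0 ∧ A (Fin.last k) *ᵥ u = 0 ∧ A ⟨k - 1, pred_lt_add_one k⟩ *ᵥ u = 0 ∧
      ((j : ℕ) = k → J *ᵥ u = 0) ∧
      (k = 1 → structPoly j J A ⟨k - 1, pred_lt_add_one k⟩ *ᵥ u ≠ 0) := by
  obtain ⟨u, v, hu, h1, h2, h3⟩ := MatPoly.exists_chain_of_two_le_index _ hk h
  obtain ⟨hK, hX, hZ⟩ := mulVec_eq_zero_of_chain (skew_ite hs.1 _) (skew_ite hs.1 _)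
    (hs.2 _) (hs.2 _) h1 h2
  refine ⟨u, hu, hX, hZ, fun hj => ?_, h3⟩
  rw [if_pos (Fin.ext (by simp [hj]))] at hK
  simpa [neg_mulVec] using hK

/-- Here `k = 1`, and `P_0` has no skew part: either `n = 1` forces `J = 0`, or `j = 1` places `J`
in the other coefficient. So `P_0 u = A_0 u = 0`, against the chain. -/
lemma not_two_le_index (hn : 1 ≤ n) (hk : 1 ≤ k) {J : Matrix (Fin n) (Fin n) ℝ}
    {A : Fin (k + 1) → Matrix (Fin n) (Fin n) ℝ} (hs : IsStructured J A)
    (hdeg : max n k = 1 ∨ ((j : ℕ) = k ∧ k = 1)) : ¬ 2 ≤ (structPoly j J A).index := by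
  intro h
  obtain ⟨u, -, -, hZ, hJ, hne⟩ := exists_chain_ker_of_two_le_index hk hs h
  have hk1 : k = 1 := by omega
  apply hne hk1
  have hJu : J *ᵥ u = 0 ∨ (⟨k - 1, pred_lt_add_one k⟩ : Fin (k + 1)) ≠ j := by
    rcases hdeg with hd | hd
    · left
      have hn1 : n = 1 := by omega
      subst hn1
      have : J = 0 := by
        ext a b
        have := congrFun (congrFun hs.1 a) b
        rw [Subsingleton.elim b a] at this ⊢
        simp only [transpose_apply, Matrix.neg_apply, Matrix.zero_apply] at this ⊢
        linarith
      rw [this, zero_mulVec]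
    · right
      intro h
      have := congrArg Fin.val h
      simp only at this
      omega
  rcases hJu with hJu | hne
  · rw [structPoly, add_mulVec, hZ]
    split_ifs <;> simp [neg_mulVec, hJu]
  · rw [structPoly_of_ne hne, hZ]

/-- The polynomials of the class that satisfy the kernel condition of the closure of the high
index polynomials. -/
def kernelSet (n k : ℕ) (j : Fin (k + 1)) : Set (MatPoly n k) :=
  {P | ∃ J A, IsStructured J A ∧ P = structPoly j J A ∧
    ∃ u : Fin n → ℝ, u ≠ 0 ∧ A (Fin.last k) *ᵥ u = 0 ∧ A ⟨k - 1, pred_lt_add_one k⟩ *ᵥ u = 0 ∧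
      ((j : ℕ) = k → J *ᵥ u = 0)}

lemma highIndexSet_subset_kernelSet (hk : 1 ≤ k) : highIndexSet n k j ⊆ kernelSet n k j := by
  rintro P ⟨⟨J, A, hs, rfl⟩, -, hP⟩
  obtain ⟨u, hu, h1, h2, h3, -⟩ := exists_chain_ker_of_two_le_index hk hs
    (by simpa [one_add_one_eq_two] using Order.add_one_le_of_lt hP)
  exact ⟨J, A, hs, rfl, u, hu, h1, h2, h3⟩

/-! ### Norms -/

lemma frobSq_nonneg (M : Matrix (Fin n) (Fin n) ℝ) : 0 ≤ frobSq M :=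
  Finset.sum_nonneg fun _ _ => Finset.sum_nonneg fun _ _ => sq_nonneg _

lemma frobSq_neg_add {K X : Matrix (Fin n) (Fin n) ℝ} (hK : Kᵀ = -K) (hX : Xᵀ = X) :
    frobSq (-K + X) = frobSq K + frobSq X := by
  have hcross : ∑ a, ∑ b, K a b * X a b = 0 := by
    have h : ∑ a, ∑ b, K a b * X a b = -∑ a, ∑ b, K a b * X a b := by
      conv_lhs => rw [Finset.sum_comm]
      rw [← Finset.sum_neg_distrib]
      refine Finset.sum_congr rfl fun a _ => ?_
      rw [← Finset.sum_neg_distrib]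
      refine Finset.sum_congr rfl fun b _ => ?_
      have h1 := congrFun (congrFun hK a) b
      have h2 := congrFun (congrFun hX a) b
      simp only [transpose_apply, Matrix.neg_apply] at h1 h2
      rw [h1, h2, neg_mul]
    linarith
  have hexp : frobSq (-K + X) = frobSq K + frobSq X - 2 * ∑ a, ∑ b, K a b * X a b := by
    simp only [frobSq, Finset.mul_sum, ← Finset.sum_add_distrib, ← Finset.sum_sub_distrib]
    refine Finset.sum_congr rfl fun a _ => Finset.sum_congr rfl fun b _ => ?_
    simp only [Matrix.add_apply, Matrix.neg_apply]
    ring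
  rw [hexp, hcross]
  ring

lemma frob_structPoly {K : Matrix (Fin n) (Fin n) ℝ} (hK : Kᵀ = -K)
    {X : Fin (k + 1) → Matrix (Fin n) (Fin n) ℝ} (hX : ∀ i, (X i)ᵀ = X i) :
    (structPoly j K X).frob = tupleFrob K X := by
  have h : ∀ i, frobSq (structPoly j K X i) = (if i = j then frobSq K else 0) + frobSq (X i) := by
    intro i
    by_cases hi : i = j
    · simp [structPoly, hi, frobSq_neg_add hK (hX j)]
    · simp [structPoly, hi]
  simp [MatPoly.frob, tupleFrob, h, Finset.sum_add_distrib]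

lemma structPoly_add (J K : Matrix (Fin n) (Fin n) ℝ)
    (A X : Fin (k + 1) → Matrix (Fin n) (Fin n) ℝ) :
    structPoly j (J + K) (A + X) = structPoly j J A + structPoly j K X := by
  ext i a b
  by_cases hi : i = j <;> simp [structPoly, hi]; ring

lemma frob_structPoly_of_isStructured {J K : Matrix (Fin n) (Fin n) ℝ}
    {A X : Fin (k + 1) → Matrix (Fin n) (Fin n) ℝ} (hs : IsStructured J A)
    (hs' : IsStructured (J + K) (A + X)) : (structPoly j K X).frob = tupleFrob K X := by
  refine frob_structPoly ?_ fun i => ?_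
  · have := hs'.1
    rw [transpose_add, hs.1, neg_add] at this
    exact add_left_cancel this
  · have := transpose_of_posSemidef (hs'.2 i)
    rw [Pi.add_apply, transpose_add, transpose_of_posSemidef (hs.2 i)] at this
    exact add_left_cancel this

/-- Perturbations inside the class correspond to perturbations of the structured tuple. -/
lemma exists_eq_structPoly_of_add_mem {J : Matrix (Fin n) (Fin n) ℝ}
    {A : Fin (k + 1) → Matrix (Fin n) (Fin n) ℝ} (hs : IsStructured J A) {Δ : MatPoly n k}
    (h : structPoly j J A + Δ ∈ structClass n k j) :
    ∃ K X, IsStructured (J + K) (A + X) ∧ Δ = structPoly j K X ∧ Δ.frob = tupleFrob K X := by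
  obtain ⟨J', A', hs', h'⟩ := h
  have hs'' : IsStructured (J + (J' - J)) (A + (A' - A)) := by simpa using hs'
  have hΔ : Δ = structPoly j (J' - J) (A' - A) := by
    have := structPoly_add (j := j) J (J' - J) A (A' - A)
    rw [add_sub_cancel, add_sub_cancel, ← h'] at this
    exact add_left_cancel this
  exact ⟨J' - J, A' - A, hs'', hΔ, hΔ ▸ frob_structPoly_of_isStructured hs hs''⟩

lemma distSing_eq_distCommonKer {J : Matrix (Fin n) (Fin n) ℝ}
    {A : Fin (k + 1) → Matrix (Fin n) (Fin n) ℝ} (hs : IsStructured J A) :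
    distSing j (structPoly j J A) = distCommonKer J A := by
  apply le_antisymm
  · refine le_iInf fun K => le_iInf fun X => le_iInf fun h => ?_
    refine iInf_le_of_le (structPoly j K X) (iInf_le_of_le ⟨?_, ?_⟩ ?_)
    · exact ⟨_, _, h.1, (structPoly_add _ _ _ _).symm⟩
    · rw [← structPoly_add]
      exact isSingular_of_commonKer_ne_bot h.2
    · rw [frob_structPoly_of_isStructured hs h.1]
  · refine le_iInf fun Δ => le_iInf fun h => ?_
    obtain ⟨K, X, hs', rfl, hfrob⟩ := exists_eq_structPoly_of_add_mem hs h.1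
    refine iInf_le_of_le K (iInf_le_of_le X (iInf_le_of_le ⟨hs', ?_⟩ ?_))
    · have := h.2
      rw [← structPoly_add] at this
      exact commonKer_ne_bot_of_det hs' (det_eval_one_eq_zero this)
    · rw [hfrob]

end Structured

end StructuredClass

section ClosureOfHighIndex

open Matrix Topology

section Closure

variable {n k : ℕ} {j : Fin (k + 1)}

/-! ### The kernel condition is closed -/

lemma isClosed_posSemidef : IsClosed {X : Matrix (Fin n) (Fin n) ℝ | X.PosSemidef} := by
  simp only [posSemidef_iff_dotProduct_mulVec, Matrix.IsHermitian, Set.ofPred_and, Set.ofPred_forall]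
  refine (isClosed_eq (by fun_prop) (by fun_prop)).inter (isClosed_iInter fun u => ?_)
  exact isClosed_le (by fun_prop) (by fun_prop)

/-- The skew-symmetric matrix `J` of a polynomial of the class. -/
def skewPart (j : Fin (k + 1)) (P : MatPoly n k) : Matrix (Fin n) (Fin n) ℝ :=
  (1 / 2 : ℝ) • ((P j)ᵀ - P j)

/-- The symmetric coefficients of a polynomial of the class. -/
def symPart (j : Fin (k + 1)) (P : MatPoly n k) (i : Fin (k + 1)) : Matrix (Fin n) (Fin n) ℝ :=
  if i = j then (1 / 2 : ℝ) • (P i + (P i)ᵀ) else P i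

lemma continuous_skewPart : Continuous (skewPart (n := n) j) := by
  unfold skewPart
  fun_prop

lemma continuous_symPart (i : Fin (k + 1)) :
    Continuous fun P : MatPoly n k => symPart j P i := by
  unfold symPart
  split_ifs <;> fun_prop

lemma skewPart_structPoly {J : Matrix (Fin n) (Fin n) ℝ}
    {A : Fin (k + 1) → Matrix (Fin n) (Fin n) ℝ} (hs : IsStructured J A) :
    skewPart j (structPoly j J A) = J := by
  simp only [skewPart, structPoly, if_true, transpose_add, transpose_neg, hs.1,
    transpose_of_posSemidef (hs.2 j), neg_neg]
  ext a b
  simp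
  ring

lemma symPart_structPoly {J : Matrix (Fin n) (Fin n) ℝ}
    {A : Fin (k + 1) → Matrix (Fin n) (Fin n) ℝ} (hs : IsStructured J A) :
    symPart j (structPoly j J A) = A := by
  funext i
  by_cases hi : i = j
  · subst hi
    simp only [symPart, structPoly, if_true, transpose_add, transpose_neg, hs.1,
      transpose_of_posSemidef (hs.2 i), neg_neg]
    ext a b
    simp
    ring
  · simp [symPart, hi, structPoly]

/-- Kernel vectors can be normalized, so the kernel condition is the projection of a closed set
along the compact unit sphere; `J` and `A` are recovered continuously from `P`. -/
lemma isClosed_kernelSet : IsClosed (kernelSet n k j) := by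
  have hJ := continuous_skewPart (n := n) (j := j)
  have hA := continuous_symPart (n := n) (j := j)
  let C : Set (Metric.sphere (0 : Fin n → ℝ) 1 × MatPoly n k) :=
    {p | symPart j p.2 (Fin.last k) *ᵥ p.1.1 = 0 ∧
      symPart j p.2 ⟨k - 1, pred_lt_add_one k⟩ *ᵥ p.1.1 = 0 ∧
      ((j : ℕ) = k → skewPart j p.2 *ᵥ p.1.1 = 0)}
  have hC : IsClosed C := by
    have hmul : ∀ F : MatPoly n k → Matrix (Fin n) (Fin n) ℝ, Continuous F →
        IsClosed {p : Metric.sphere (0 : Fin n → ℝ) 1 × MatPoly n k | F p.2 *ᵥ p.1.1 = 0} :=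
      fun F hF => isClosed_eq
        ((hF.comp continuous_snd).matrix_mulVec (continuous_subtype_val.comp continuous_fst))
        continuous_const
    refine (hmul _ (hA _)).inter ((hmul _ (hA _)).inter ?_)
    change IsClosed {p : Metric.sphere (0 : Fin n → ℝ) 1 × MatPoly n k |
      (j : ℕ) = k → skewPart j p.2 *ᵥ p.1.1 = 0}
    by_cases hj : (j : ℕ) = k
    · simpa only [hj, true_imp_iff] using hmul _ hJ
    · simp only [hj, false_imp_iff]
      exact isClosed_univ
  have heq : kernelSet n k j =
      ({P | (skewPart j P)ᵀ = -skewPart j P} ∩ ⋂ i, {P | (symPart j P i).PosSemidef}) ∩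
        ({P | P = structPoly j (skewPart j P) (symPart j P)} ∩ Prod.snd '' C) := by
    ext P
    constructor
    · rintro ⟨J, A, hs, rfl, u, hu, h1, h2, h3⟩
      simp only [Set.mem_inter_iff, Set.mem_iInter, Set.mem_ofPred_eq, skewPart_structPoly hs,
        symPart_structPoly hs]
      have hu' : ‖u‖ ≠ 0 := norm_ne_zero_iff.2 hu
      refine ⟨⟨hs.1, hs.2⟩, trivial, ⟨⟨‖u‖⁻¹ • u, ?_⟩, structPoly j J A⟩, ?_, rfl⟩
      · simp [norm_smul, hu']
      · simp only [C, Set.mem_ofPred_eq, skewPart_structPoly hs, symPart_structPoly hs, mulVec_smul,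
          h1, h2, smul_zero, true_and]
        intro hj
        rw [h3 hj, smul_zero]
    · rintro ⟨⟨h1, h2⟩, h3, ⟨⟨u, hu⟩, Q⟩, ⟨h4, h5, h6⟩, rfl⟩
      refine ⟨_, _, ⟨h1, Set.mem_iInter.1 h2⟩, h3, u, ?_, h4, h5, h6⟩
      rintro rfl
      simp at hu
  rw [heq]
  refine (IsClosed.inter ?_ (isClosed_iInter fun i => ?_)).inter (IsClosed.inter ?_ ?_)
  · exact isClosed_eq hJ.matrix_transpose hJ.neg
  · exact isClosed_posSemidef.preimage (hA i)
  · refine isClosed_eq continuous_id (continuous_pi fun i => ?_)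
    unfold structPoly
    refine Continuous.add ?_ (hA i)
    split_ifs
    · exact hJ.neg
    · exact continuous_const
  · exact isClosedMap_snd_of_compactSpace _ hC

/-! ### Density of the high index polynomials -/

/-- The matrix `|u|² I - u uᵀ`, which is semidefinite with kernel spanned by `u`. -/
def orthProj (u : Fin n → ℝ) : Matrix (Fin n) (Fin n) ℝ := (u ⬝ᵥ u) • 1 - vecMulVec u u

lemma orthProj_mulVec (u x : Fin n → ℝ) :
    orthProj u *ᵥ x = (u ⬝ᵥ u) • x - (u ⬝ᵥ x) • u := by
  ext a
  simp [orthProj, sub_mulVec, smul_mulVec, vecMulVec_mulVec, mul_comm]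

lemma orthProj_mulVec_self (u : Fin n → ℝ) : orthProj u *ᵥ u = 0 := by
  rw [orthProj_mulVec, sub_self]

lemma posSemidef_orthProj (u : Fin n → ℝ) : (orthProj u).PosSemidef := by
  refine .of_dotProduct_mulVec_nonneg ?_ fun x => ?_
  · ext a b
    simp [orthProj, vecMulVec_apply, Matrix.one_apply, eq_comm, mul_comm]
  · rw [orthProj_mulVec]
    simp only [star_trivial, dotProduct_sub, dotProduct_smul, smul_eq_mul]
    have : (u ⬝ᵥ x) ^ 2 ≤ (u ⬝ᵥ u) * (x ⬝ᵥ x) := by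
      simpa [dotProduct, sq] using Finset.sum_mul_sq_le_sq_mul_sq Finset.univ u x
    rw [dotProduct_comm x u]
    nlinarith

lemma mulVec_eq_zero_of_add {X Y : Matrix (Fin n) (Fin n) ℝ} (hX : X.PosSemidef)
    (hY : Y.PosSemidef) {x : Fin n → ℝ} (h : (X + Y) *ᵥ x = 0) : X *ᵥ x = 0 ∧ Y *ᵥ x = 0 := by
  have h1 := congrArg (x ⬝ᵥ ·) h
  simp only [add_mulVec, dotProduct_add, dotProduct_zero] at h1
  have h2 := dotProduct_mulVec_nonneg hX x
  have h3 := dotProduct_mulVec_nonneg hY x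
  exact ⟨mulVec_eq_zero_of_dotProduct hX (by linarith),
    mulVec_eq_zero_of_dotProduct hY (by linarith)⟩

lemma eq_smul_of_orthProj_mulVec {u x : Fin n → ℝ} (hu : u ≠ 0) (h : orthProj u *ᵥ x = 0) :
    ∃ c : ℝ, x = c • u := by
  have hu' : u ⬝ᵥ u ≠ 0 := fun h0 => hu (dotProduct_self_eq_zero.1 h0)
  rw [orthProj_mulVec, sub_eq_zero] at h
  refine ⟨(u ⬝ᵥ u)⁻¹ * (u ⬝ᵥ x), ?_⟩
  rw [mul_smul, ← h, smul_smul, inv_mul_cancel₀ hu', one_smul]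

/-- A semidefinite matrix with kernel spanned by `u` has range `u^⊥`. -/
lemma exists_mulVec_eq_of_dotProduct {X : Matrix (Fin n) (Fin n) ℝ} (hX : X.PosSemidef)
    {u w : Fin n → ℝ} (hu : u ≠ 0) (hXu : X *ᵥ u = 0)
    (hker : ∀ x, X *ᵥ x = 0 → ∃ c : ℝ, x = c • u) (hw : u ⬝ᵥ w = 0) : ∃ v, X *ᵥ v = w := by
  have hu' : u ⬝ᵥ u ≠ 0 := fun h0 => hu (dotProduct_self_eq_zero.1 h0)
  have huu : (vecMulVec u u).PosSemidef := by
    simpa using posSemidef_vecMulVec_self_star u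
  have hmul : ∀ x, vecMulVec u u *ᵥ x = (u ⬝ᵥ x) • u := by
    intro x
    ext a
    simp [vecMulVec_mulVec, mul_comm]
  -- Adding `u uᵀ` removes the kernel. Pairing the solution of the modified system with `u` shows
  -- that the added term contributes nothing.
  have hunit : IsUnit (X + vecMulVec u u) := by
    rw [Matrix.isUnit_iff_isUnit_det, isUnit_iff_ne_zero]
    intro hdet
    obtain ⟨x, hx, hx0⟩ := Matrix.exists_mulVec_eq_zero_iff.2 hdet
    obtain ⟨h1, h2⟩ := mulVec_eq_zero_of_add hX huu hx0
    obtain ⟨c, rfl⟩ := hker x h1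
    rw [hmul, dotProduct_smul, smul_eq_mul] at h2
    have hc : c = 0 := by simpa [hu, hu'] using h2
    exact hx (by rw [hc, zero_smul])
  obtain ⟨v, hv⟩ := (Matrix.mulVec_surjective_iff_isUnit.2 hunit) w
  refine ⟨v, ?_⟩
  rw [add_mulVec, hmul] at hv
  have h1 := congrArg (u ⬝ᵥ ·) hv
  simp only [dotProduct_add, dotProduct_smul, hw, smul_eq_mul] at h1
  rw [dotProduct_mulVec, ← mulVec_transpose, transpose_of_posSemidef hX, hXu, zero_dotProduct,
    zero_add] at h1
  have h2 : u ⬝ᵥ v = 0 := by simpa [hu, hu'] using h1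
  rwa [h2, zero_smul, add_zero] at hv

lemma exists_skew_mulVec_ne_zero (hn : 2 ≤ n) {u : Fin n → ℝ} (hu : u ≠ 0) :
    ∃ K : Matrix (Fin n) (Fin n) ℝ, Kᵀ = -K ∧ K *ᵥ u ≠ 0 := by
  obtain ⟨a, ha⟩ := Function.ne_iff.1 hu
  have : Nontrivial (Fin n) := Fin.nontrivial_iff_two_le.2 hn
  obtain ⟨b, hb⟩ := exists_ne a
  refine ⟨single a b 1 - single b a 1, ?_, fun h => ha ?_⟩
  · simp [transpose_sub, transpose_single]
  · have := congrFun h b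
    simpa [sub_mulVec, single_mulVec, hb, Function.update_apply] using this

/-- A polynomial of the class with the kernel condition whose leading coefficient has a
one-dimensional symmetric kernel is a high index polynomial as soon as it is regular. -/
lemma mem_highIndexSet (hk : 1 ≤ k) {J : Matrix (Fin n) (Fin n) ℝ}
    {A : Fin (k + 1) → Matrix (Fin n) (Fin n) ℝ} (hs : IsStructured J A)
    {u : Fin n → ℝ} (hu : u ≠ 0) (hlast : A (Fin.last k) *ᵥ u = 0)
    (hpred : A ⟨k - 1, pred_lt_add_one k⟩ *ᵥ u = 0) (hJ : (j : ℕ) = k → J *ᵥ u = 0)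
    (hker : ∀ x, A (Fin.last k) *ᵥ x = 0 → ∃ c : ℝ, x = c • u)
    (hreg : ∀ x, J *ᵥ x = 0 → (∀ i, A i *ᵥ x = 0) → x = 0) :
    structPoly j J A ∈ highIndexSet n k j := by
  have hdet : ((structPoly j J A).eval 1).det ≠ 0 := by
    intro h
    obtain ⟨x, hx, hx0⟩ := (Submodule.ne_bot_iff _).1 (commonKer_ne_bot_of_det hs h)
    obtain ⟨h1, h2⟩ := mem_commonKer.1 hx
    exact hx0 (hreg x h1 h2)
  refine ⟨⟨J, A, hs, rfl⟩, fun h => hdet (det_eval_one_eq_zero h), ?_⟩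
  refine lt_of_lt_of_le (by norm_num : (1 : ℕ∞) < 2) ?_
  -- Only for `j = k - 1` is `P_{k-1} u = -J u` possibly nonzero; it is orthogonal to `u` by
  -- skewness, hence in the range of `P_k = A_k`.
  by_cases hj : (⟨k - 1, pred_lt_add_one k⟩ : Fin (k + 1)) = j
  · have hjl : Fin.last k ≠ j := by
      intro h
      have h1 := congrArg Fin.val (h.trans hj.symm)
      simp only [Fin.val_last] at h1
      omega
    obtain ⟨v, hv⟩ := exists_mulVec_eq_of_dotProduct (hs.2 (Fin.last k)) hu hlast hker
      (w := -(J *ᵥ u)) (by rw [dotProduct_neg, dotProduct_mulVec_self_of_skew hs.1, neg_zero])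
    refine MatPoly.two_le_index_of_chain _ hk hdet (v := v) hu ?_ ?_
    · rw [structPoly_of_ne hjl, hlast]
    · rw [structPoly_of_ne hjl, hv, structPoly, if_pos hj, add_mulVec, hpred, add_zero, neg_mulVec]
  · refine MatPoly.two_le_index_of_chain _ hk hdet (v := 0) hu ?_ ?_
    · by_cases hjl : Fin.last k = j
      · rw [structPoly, add_mulVec, hlast, if_pos hjl, neg_mulVec,
          hJ (by rw [← hjl, Fin.val_last])]
        simp
      · rw [structPoly_of_ne hjl, hlast]
    · rw [structPoly_of_ne hj, hpred, mulVec_zero]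

/-- Adding a small multiple of `orthProj u` to `A_k` shrinks its kernel to the line of `u`.
Regularity then only requires some part that moves `u` without disturbing the kernel condition: the
coefficient `A_0` when `k ≥ 2`, the matrix `J` when `k = 1`. -/
lemma kernelSet_subset_closure (hk : 1 ≤ k) (hmax : 1 < max n k)
    (hjk : ¬ ((j : ℕ) = k ∧ k = 1)) : kernelSet n k j ⊆ closure (highIndexSet n k j) := by
  rintro P ⟨J, A, hs, rfl, u, hu, h1, h2, h3⟩
  obtain ⟨K, X, hK, hX, hXu, hX0, hKk, hreg⟩ : ∃ (K : Matrix (Fin n) (Fin n) ℝ)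
      (X : Fin (k + 1) → Matrix (Fin n) (Fin n) ℝ), Kᵀ = -K ∧ (∀ i, (X i).PosSemidef) ∧
      X (Fin.last k) = orthProj u ∧ X ⟨k - 1, pred_lt_add_one k⟩ *ᵥ u = 0 ∧
      ((j : ℕ) = k → K = 0) ∧
      ∀ ε > (0 : ℝ), ((∀ i, X i *ᵥ u = 0) → (J + ε • K) *ᵥ u ≠ 0) := by
    by_cases hk1 : k = 1
    · have hX : ∀ i : Fin (k + 1),
          (if i = Fin.last k then orthProj u else 0 : Matrix (Fin n) (Fin n) ℝ).PosSemidef := by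
        intro i
        split_ifs
        · exact posSemidef_orthProj u
        · exact PosSemidef.zero
      have hXk : (if (⟨k - 1, pred_lt_add_one k⟩ : Fin (k + 1)) = Fin.last k then orthProj u
          else 0 : Matrix (Fin n) (Fin n) ℝ) *ᵥ u = 0 := by
        split_ifs
        · exact orthProj_mulVec_self u
        · exact zero_mulVec u
      -- For `k = 1` both semidefinite coefficients must annihilate `u`. A skew matrix can move `u`
      -- since `n ≥ 2`, and is allowed to since `j < k`.
      by_cases hJu : J *ᵥ u = 0
      · obtain ⟨K, hK, hKu⟩ := exists_skew_mulVec_ne_zero (by omega) hu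
        refine ⟨K, fun i => if i = Fin.last k then orthProj u else 0, hK, hX, if_pos rfl, hXk,
          fun hj => absurd ⟨hj, hk1⟩ hjk, fun ε hε _ => ?_⟩
        rw [add_mulVec, hJu, zero_add, smul_mulVec]
        exact smul_ne_zero hε.ne' hKu
      · refine ⟨0, fun i => if i = Fin.last k then orthProj u else 0, by simp, hX, if_pos rfl, hXk,
          fun _ => rfl, fun ε hε _ => by simpa using hJu⟩
    · have h0l : (0 : Fin (k + 1)) ≠ Fin.last k := by
        intro h
        have := congrArg Fin.val h
        simp only [Fin.val_zero, Fin.val_last] at this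
        omega
      refine ⟨0, fun i => if i = Fin.last k then orthProj u else if i = 0 then 1 else 0, by simp,
        fun i => ?_, if_pos rfl, ?_, fun _ => rfl, fun ε _ h => absurd (h 0) ?_⟩
      · dsimp only
        split_ifs
        · exact posSemidef_orthProj u
        · exact PosSemidef.one
        · exact PosSemidef.zero
      · have hne : (⟨k - 1, pred_lt_add_one k⟩ : Fin (k + 1)) ≠ 0 := by
          intro h
          have := congrArg Fin.val h
          simp only [Fin.val_zero] at this
          omega
        dsimp only
        rw [if_neg hne]
        split_ifs
        · exact orthProj_mulVec_self u
        · exact zero_mulVec u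
      · simpa [h0l] using hu
  have hcont : Continuous fun ε : ℝ => structPoly j (J + ε • K) (A + ε • X) := by
    refine continuous_pi fun i => ?_
    simp only [structPoly, Pi.add_apply, Pi.smul_apply]
    split_ifs <;> fun_prop
  have hlim : Filter.Tendsto (fun ε : ℝ => structPoly j (J + ε • K) (A + ε • X)) (𝓝[>] 0)
      (𝓝 (structPoly j J A)) := by
    have := (hcont.tendsto 0).mono_left (nhdsWithin_le_nhds (s := Set.Ioi 0))
    simpa using this
  refine mem_closure_of_tendsto hlim ?_
  filter_upwards [self_mem_nhdsWithin] with ε hε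
  have hε' : (0 : ℝ) < ε := hε
  have hsplit : ∀ i x, (A + ε • X) i *ᵥ x = 0 → A i *ᵥ x = 0 ∧ X i *ᵥ x = 0 := by
    intro i x h
    obtain ⟨ha, hb⟩ := mulVec_eq_zero_of_add (hs.2 i) ((hX i).smul hε'.le) h
    rw [smul_mulVec] at hb
    exact ⟨ha, (smul_eq_zero.1 hb).resolve_left hε'.ne'⟩
  have hs' : IsStructured (J + ε • K) (A + ε • X) :=
    ⟨by rw [transpose_add, transpose_smul, hs.1, hK]; simp [add_comm],
      fun i => (hs.2 i).add ((hX i).smul hε'.le)⟩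
  have hker : ∀ x, (A + ε • X) (Fin.last k) *ᵥ x = 0 → ∃ c : ℝ, x = c • u := by
    intro x hx
    have := (hsplit _ x hx).2
    rw [hXu] at this
    exact eq_smul_of_orthProj_mulVec hu this
  refine mem_highIndexSet hk hs' hu ?_ ?_ ?_ hker ?_
  · rw [Pi.add_apply, add_mulVec, h1, Pi.smul_apply, smul_mulVec, hXu, orthProj_mulVec_self]
    simp
  · rw [Pi.add_apply, add_mulVec, h2, Pi.smul_apply, smul_mulVec, hX0]
    simp
  · intro hj
    rw [hKk hj, smul_zero, add_zero, h3 hj]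
  · intro x hx hxA
    obtain ⟨c, rfl⟩ := hker x (hxA _)
    by_contra hc
    have hc' : c ≠ 0 := fun h => hc (by rw [h, zero_smul])
    rw [mulVec_smul] at hx
    refine hreg ε hε' (fun i => ?_) ((smul_eq_zero.1 hx).resolve_left hc')
    have := (hsplit i _ (hxA i)).2
    rw [mulVec_smul] at this
    exact (smul_eq_zero.1 this).resolve_left hc'

lemma closure_highIndexSet (hk : 1 ≤ k) (hmax : 1 < max n k) (hjk : ¬ ((j : ℕ) = k ∧ k = 1)) :
    closure (highIndexSet n k j) = kernelSet n k j :=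
  (closure_minimal (highIndexSet_subset_kernelSet hk) isClosed_kernelSet).antisymm
    (kernelSet_subset_closure hk hmax hjk)

end Closure

end ClosureOfHighIndex

/-! ### Distance to high index as distance to a common kernel -/

section Distances

open Matrix

section Distance

variable {n k : ℕ} {j : Fin (k + 1)}

lemma continuous_frobSq : Continuous (frobSq (n := n)) := by
  unfold frobSq
  fun_prop

lemma continuous_frob : Continuous (MatPoly.frob (n := n) (k := k)) := by
  unfold MatPoly.frob
  exact (continuous_finsetSum _ fun i _ =>
    continuous_frobSq.comp (continuous_apply i)).sqrt

/-- The norm is continuous, so the infimum is bounded by the distance to any limit of high index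
polynomials, even one that is singular. -/
lemma distHighIndex_le_of_mem_closure {P Q : MatPoly n k}
    (hQ : Q ∈ closure (highIndexSet n k j)) :
    distHighIndex j P ≤ ENNReal.ofReal (Q - P).frob := by
  have hcl : IsClosed {Q : MatPoly n k | distHighIndex j P ≤ ENNReal.ofReal (Q - P).frob} :=
    isClosed_le continuous_const
      (ENNReal.continuous_ofReal.comp (continuous_frob.comp (continuous_id.sub continuous_const)))
  refine closure_minimal (fun R hR => ?_) hcl hQ
  refine iInf₂_le (f := fun (Δ : MatPoly n k)
    (_ : P + Δ ∈ structClass n k j ∧ 2 ≤ (P + Δ).index) => ENNReal.ofReal Δ.frob) (R - P) ?_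
  rw [add_sub_cancel]
  exact ⟨hR.1, by simpa [one_add_one_eq_two] using Order.add_one_le_of_lt hR.2.2⟩

lemma sum_frobSq_ite {p q : Fin (k + 1)} (hpq : q ≠ p) (X Y : Matrix (Fin n) (Fin n) ℝ) :
    ∑ i, frobSq (if i = p then X else if i = q then Y else 0) = frobSq X + frobSq Y := by
  have h : ∀ i, frobSq (if i = p then X else if i = q then Y else 0) =
      (if i = p then frobSq X else 0) + (if i = q then frobSq Y else 0) := by
    intro i
    by_cases hp : i = p
    · subst hp
      simp [hpq.symm]
    · by_cases hq : i = q <;> simp [hp, hq, frobSq, hpq]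
  simp [h, Finset.sum_add_distrib]

lemma last_ne_pred (hk : 1 ≤ k) : (⟨k - 1, pred_lt_add_one k⟩ : Fin (k + 1)) ≠ Fin.last k := by
  intro h
  have := congrArg Fin.val h
  simp only [Fin.val_last] at this
  omega

/-- Structured perturbations of `(J₀, A_k, A_{k-1})` with a common kernel bound the distance to
the high index polynomials, if the perturbation of `J₀` lifts to one of `J`. -/
lemma distHighIndex_le (hk : 1 ≤ k) (hmax : 1 < max n k) (hjk : ¬ ((j : ℕ) = k ∧ k = 1))
    {J K K' : Matrix (Fin n) (Fin n) ℝ} {A : Fin (k + 1) → Matrix (Fin n) (Fin n) ℝ}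
    (hs : IsStructured J A) {X : Fin 2 → Matrix (Fin n) (Fin n) ℝ}
    (hK : (J + K)ᵀ = -(J + K)) (hKK' : frobSq K ≤ frobSq K')
    (hX : ∀ i, ((![A (Fin.last k), A ⟨k - 1, pred_lt_add_one k⟩] + X) i).PosSemidef)
    {u : Fin n → ℝ} (hu : u ≠ 0) (hJu : (j : ℕ) = k → (J + K) *ᵥ u = 0)
    (hXu : ∀ i, (![A (Fin.last k), A ⟨k - 1, pred_lt_add_one k⟩] + X) i *ᵥ u = 0) :
    distHighIndex j (structPoly j J A) ≤ ENNReal.ofReal (tupleFrob K' X) := by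
  have hne := last_ne_pred hk
  let Y : Fin (k + 1) → Matrix (Fin n) (Fin n) ℝ := fun i =>
    if i = Fin.last k then X 0 else if i = ⟨k - 1, pred_lt_add_one k⟩ then X 1 else 0
  have hY0 : Y (Fin.last k) = X 0 := if_pos rfl
  have hY1 : Y ⟨k - 1, pred_lt_add_one k⟩ = X 1 := by simp only [Y, if_neg hne, if_true]
  have hs' : IsStructured (J + K) (A + Y) := by
    refine ⟨hK, fun i => ?_⟩
    rw [Pi.add_apply]
    by_cases h0 : i = Fin.last k
    · rw [h0, hY0]
      exact hX 0
    · by_cases h1 : i = ⟨k - 1, pred_lt_add_one k⟩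
      · rw [h1, hY1]
        exact hX 1
      · simpa [Y, h0, h1] using hs.2 i
  have hmem : structPoly j (J + K) (A + Y) ∈ closure (highIndexSet n k j) := by
    rw [closure_highIndexSet hk hmax hjk]
    refine ⟨_, _, hs', rfl, u, hu, ?_, ?_, hJu⟩
    · rw [Pi.add_apply, hY0]
      exact hXu 0
    · rw [Pi.add_apply, hY1]
      exact hXu 1
  refine (distHighIndex_le_of_mem_closure hmem).trans (ENNReal.ofReal_le_ofReal ?_)
  rw [structPoly_add, add_sub_cancel_left, frob_structPoly_of_isStructured hs hs']
  refine Real.sqrt_le_sqrt (add_le_add hKK' ?_)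
  simp only [Y, sum_frobSq_ite hne]
  exact (Fin.sum_univ_two fun i => frobSq (X i)).ge

/-- Perturbations inside the class to index at least two yield a common kernel. -/
lemma exists_commonKer_of_high_index (hk : 1 ≤ k) {J : Matrix (Fin n) (Fin n) ℝ}
    {A : Fin (k + 1) → Matrix (Fin n) (Fin n) ℝ} (hs : IsStructured J A) {Δ : MatPoly n k}
    (h : structPoly j J A + Δ ∈ structClass n k j)
    (h2 : 2 ≤ (structPoly j J A + Δ).index) :
    ∃ (K : Matrix (Fin n) (Fin n) ℝ) (X : Fin 2 → Matrix (Fin n) (Fin n) ℝ) (u : Fin n → ℝ),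
      (J + K)ᵀ = -(J + K) ∧
      (∀ i, ((![A (Fin.last k), A ⟨k - 1, pred_lt_add_one k⟩] + X) i).PosSemidef) ∧ u ≠ 0 ∧
      ((j : ℕ) = k → (J + K) *ᵥ u = 0) ∧
      (∀ i, (![A (Fin.last k), A ⟨k - 1, pred_lt_add_one k⟩] + X) i *ᵥ u = 0) ∧
      tupleFrob K X ≤ Δ.frob := by
  obtain ⟨K, Y, hs', rfl, hfrob⟩ := exists_eq_structPoly_of_add_mem hs h
  rw [← structPoly_add] at h2
  obtain ⟨u, hu, h1, h2, h3, -⟩ := exists_chain_ker_of_two_le_index hk hs' h2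
  refine ⟨K, ![Y (Fin.last k), Y ⟨k - 1, pred_lt_add_one k⟩], u, hs'.1, ?_, hu, h3, ?_, ?_⟩
  · intro i
    fin_cases i
    · exact hs'.2 (Fin.last k)
    · exact hs'.2 ⟨k - 1, pred_lt_add_one k⟩
  · intro i
    fin_cases i
    · exact h1
    · exact h2
  · rw [hfrob]
    refine Real.sqrt_le_sqrt (add_le_add le_rfl ?_)
    rw [Fin.sum_univ_two]
    have := Finset.sum_le_sum_of_subset_of_nonneg
      (Finset.subset_univ {Fin.last k, (⟨k - 1, pred_lt_add_one k⟩ : Fin (k + 1))})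
      (fun i _ _ => frobSq_nonneg (Y i))
    rwa [Finset.sum_pair (last_ne_pred hk).symm] at this

lemma tupleFrob_zero_le {l : ℕ} (K : Matrix (Fin n) (Fin n) ℝ)
    (X : Fin (l + 1) → Matrix (Fin n) (Fin n) ℝ) : tupleFrob 0 X ≤ tupleFrob K X := by
  refine Real.sqrt_le_sqrt (add_le_add ?_ le_rfl)
  simpa [frobSq] using frobSq_nonneg K

/-- For `j < k` the kernel condition ignores `J`, so perturbing `J`, or the zero matrix in its
place, only adds to the norm; both directions discard that perturbation. -/
lemma distHighIndex_eq_of_lt (hk : 1 ≤ k) (hmax : 1 < max n k) (hj : (j : ℕ) < k)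
    {J : Matrix (Fin n) (Fin n) ℝ} {A : Fin (k + 1) → Matrix (Fin n) (Fin n) ℝ}
    (hs : IsStructured J A) :
    distHighIndex j (structPoly j J A) =
      distCommonKer 0 ![A (Fin.last k), A ⟨k - 1, pred_lt_add_one k⟩] := by
  apply le_antisymm
  · refine le_iInf fun K => le_iInf fun X => le_iInf fun h => ?_
    obtain ⟨u, hu, hu0⟩ := (Submodule.ne_bot_iff _).1 h.2
    refine distHighIndex_le hk hmax (by omega) (K := 0) hs (by simpa using hs.1) ?_ h.1.2 hu0
      (by omega) (mem_commonKer.1 hu).2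
    simpa [frobSq] using frobSq_nonneg K
  · refine le_iInf fun Δ => le_iInf fun h => ?_
    obtain ⟨K, X, u, -, hX, hu, -, hXu, hle⟩ := exists_commonKer_of_high_index hk hs h.1 h.2
    refine iInf_le_of_le 0 (iInf_le_of_le X (iInf_le_of_le ⟨⟨by simp, hX⟩, ?_⟩
      (ENNReal.ofReal_le_ofReal ((tupleFrob_zero_le K X).trans hle))))
    exact (Submodule.ne_bot_iff _).2 ⟨u, mem_commonKer.2 ⟨by simp, hXu⟩, hu⟩

lemma distHighIndex_eq_of_eq (hk : 1 < k) (hj : (j : ℕ) = k)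
    {J : Matrix (Fin n) (Fin n) ℝ} {A : Fin (k + 1) → Matrix (Fin n) (Fin n) ℝ}
    (hs : IsStructured J A) :
    distHighIndex j (structPoly j J A) =
      distCommonKer J ![A (Fin.last k), A ⟨k - 1, pred_lt_add_one k⟩] := by
  apply le_antisymm
  · refine le_iInf fun K => le_iInf fun X => le_iInf fun h => ?_
    obtain ⟨u, hu, hu0⟩ := (Submodule.ne_bot_iff _).1 h.2
    obtain ⟨hJu, hXu⟩ := mem_commonKer.1 hu
    exact distHighIndex_le hk.le (by omega) (by omega) hs h.1.1 le_rfl h.1.2 hu0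
      (fun _ => hJu) hXu
  · refine le_iInf fun Δ => le_iInf fun h => ?_
    obtain ⟨K, X, u, hK, hX, hu, hJu, hXu, hle⟩ := exists_commonKer_of_high_index hk.le hs h.1 h.2
    refine iInf_le_of_le K (iInf_le_of_le X (iInf_le_of_le ⟨⟨hK, hX⟩, ?_⟩
      (ENNReal.ofReal_le_ofReal hle)))
    exact (Submodule.ne_bot_iff _).2 ⟨u, mem_commonKer.2 ⟨hJu hj, hXu⟩, hu⟩

lemma distHighIndex_eq_top (hn : 1 ≤ n) (hk : 1 ≤ k)
    (hdeg : max n k = 1 ∨ ((j : ℕ) = k ∧ k = 1)) (P : MatPoly n k) : distHighIndex j P = ⊤ := by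
  refine iInf₂_eq_top.2 fun Δ h => ?_
  obtain ⟨⟨J, A, hs, hP⟩, h2⟩ := h
  rw [hP] at h2
  exact absurd h2 (not_two_le_index hn hk hs hdeg)

lemma highIndexSet_eq_empty (hn : 1 ≤ n) (hk : 1 ≤ k)
    (hdeg : max n k = 1 ∨ ((j : ℕ) = k ∧ k = 1)) : highIndexSet n k j = ∅ := by
  refine Set.eq_empty_of_forall_notMem ?_
  rintro P ⟨⟨J, A, hs, rfl⟩, -, hP⟩
  exact not_two_le_index hn hk hs hdeg
    (by simpa [one_add_one_eq_two] using Order.add_one_le_of_lt hP)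

lemma kernelSet_eq_of_lt (hj : (j : ℕ) < k) : kernelSet n k j =
    {P | ∃ (J : Matrix (Fin n) (Fin n) ℝ) (A : Fin (k + 1) → Matrix (Fin n) (Fin n) ℝ),
      IsStructured J A ∧ P = structPoly j J A ∧
      matKer (A (Fin.last k)) ⊓ matKer (A ⟨k - 1, pred_lt_add_one k⟩) ≠ ⊥} := by
  ext P
  refine exists_congr fun J => exists_congr fun A => and_congr_right fun _ =>
    and_congr_right fun _ => ?_
  rw [Submodule.ne_bot_iff]
  refine exists_congr fun u => ?_
  simp only [matKer, Submodule.mem_inf, LinearMap.mem_ker, mulVecLin_apply, hj.ne,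
    false_imp_iff, and_true]
  tauto

lemma kernelSet_eq_of_eq (hj : (j : ℕ) = k) : kernelSet n k j =
    {P | ∃ (J : Matrix (Fin n) (Fin n) ℝ) (A : Fin (k + 1) → Matrix (Fin n) (Fin n) ℝ),
      IsStructured J A ∧ P = structPoly j J A ∧
      matKer J ⊓ matKer (A (Fin.last k)) ⊓ matKer (A ⟨k - 1, pred_lt_add_one k⟩) ≠ ⊥} := by
  ext P
  refine exists_congr fun J => exists_congr fun A => and_congr_right fun _ =>
    and_congr_right fun _ => ?_
  rw [Submodule.ne_bot_iff]
  refine exists_congr fun u => ?_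
  simp only [matKer, Submodule.mem_inf, LinearMap.mem_ker, mulVecLin_apply, hj, true_imp_iff]
  tauto

end Distance

end Distances

end DissHam

end

theorem theorem4p10 (n k : ℕ) (hn : 1 ≤ n) (hk : 1 ≤ k) (j : Fin (k + 1)) :
    -- (i) characterization of singularity
    (∀ (J : Matrix (Fin n) (Fin n) ℝ) (A : Fin (k + 1) → Matrix (Fin n) (Fin n) ℝ),
      DissHam.IsStructured J A →
        [(DissHam.structPoly j J A).IsSingular,
          ((DissHam.structPoly j J A).eval 1).det = 0,
          DissHam.commonKer J A ≠ ⊥].TFAE) ∧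
    -- (ii) the distance to singularity
    (∀ (J : Matrix (Fin n) (Fin n) ℝ) (A : Fin (k + 1) → Matrix (Fin n) (Fin n) ℝ),
      DissHam.IsStructured J A →
        DissHam.distSing j (DissHam.structPoly j J A) = DissHam.distCommonKer J A) ∧
    -- (iii) the closure of the set of regular polynomials of index greater than one
    ((1 < max n k →
        ((j : ℕ) < k →
          closure (DissHam.highIndexSet n k j) =
            {P | ∃ (J : Matrix (Fin n) (Fin n) ℝ) (A : Fin (k + 1) → Matrix (Fin n) (Fin n) ℝ),
              DissHam.IsStructured J A ∧ P = DissHam.structPoly j J A ∧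
              DissHam.matKer (A (Fin.last k)) ⊓ DissHam.matKer (A ⟨k - 1, by omega⟩) ≠ ⊥}) ∧
        ((j : ℕ) = k → 1 < k →
          closure (DissHam.highIndexSet n k j) =
            {P | ∃ (J : Matrix (Fin n) (Fin n) ℝ) (A : Fin (k + 1) → Matrix (Fin n) (Fin n) ℝ),
              DissHam.IsStructured J A ∧ P = DissHam.structPoly j J A ∧
              DissHam.matKer J ⊓ DissHam.matKer (A (Fin.last k)) ⊓
                DissHam.matKer (A ⟨k - 1, by omega⟩) ≠ ⊥})) ∧
      (max n k = 1 ∨ ((j : ℕ) = k ∧ k = 1) → DissHam.highIndexSet n k j = ∅)) ∧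
    -- (iv) the distance to the nearest high index problem
    (∀ (J : Matrix (Fin n) (Fin n) ℝ) (A : Fin (k + 1) → Matrix (Fin n) (Fin n) ℝ),
      DissHam.IsStructured J A →
        (1 < max n k →
          ((j : ℕ) < k →
            DissHam.distHighIndex j (DissHam.structPoly j J A) =
              DissHam.distCommonKer 0 ![A (Fin.last k), A ⟨k - 1, by omega⟩]) ∧
          ((j : ℕ) = k → 1 < k →
            DissHam.distHighIndex j (DissHam.structPoly j J A) =
              DissHam.distCommonKer J ![A (Fin.last k), A ⟨k - 1, by omega⟩])) ∧
        (max n k = 1 ∨ ((j : ℕ) = k ∧ k = 1) →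
          DissHam.distHighIndex j (DissHam.structPoly j J A) = ⊤)) := by
  refine ⟨fun J A hs => ?_, fun J A hs => DissHam.distSing_eq_distCommonKer hs,
    ⟨fun hmax => ⟨fun hj => ?_, fun hj hk1 => ?_⟩,
      fun hdeg => DissHam.highIndexSet_eq_empty hn hk hdeg⟩,
    fun J A hs => ⟨fun hmax => ⟨fun hj => DissHam.distHighIndex_eq_of_lt hk hmax hj hs,
      fun hj hk1 => DissHam.distHighIndex_eq_of_eq hk1 hj hs⟩,
      fun hdeg => DissHam.distHighIndex_eq_top hn hk hdeg _⟩⟩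
  · tfae_have 1 → 2 := DissHam.det_eval_one_eq_zero
    tfae_have 2 → 3 := DissHam.commonKer_ne_bot_of_det hs
    tfae_have 3 → 1 := DissHam.isSingular_of_commonKer_ne_bot
    tfae_finish
  · rw [DissHam.closure_highIndexSet hk hmax (by omega), DissHam.kernelSet_eq_of_lt hj]
  · rw [DissHam.closure_highIndexSet hk hmax (by omega), DissHam.kernelSet_eq_of_eq hj]
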